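/- Let $I$ be a nonempty finite set. A \emph{tree} on $I$ is a (non-planar) rooted binary tree whose leaves are bijectively labeled by $I$; a \emph{forest} on $I$ is a set of such trees whose label sets partition $I$. Trees and forests are considered up to label-preserving isomorphism, edges are oriented towards the root, and $\mathcal V(F)$ denotes the set of inner vertices of a forest $F$ (the vertices with two children). A leaf is an \emph{ancestor leaf} of a vertex $v$ if its path to the root goes through $v$. Let $\operatorname{For}(I)$ be the set of forests on $I$, with the partial order in which $F\le G$ if and only if there is a topological map from $F$ to $G$ that is increasing with respect to the orientation towards the root, maps inner vertices to inner vertices injectively, restricts to the identity of $I$ on leaves, and is injective on each tree of $F$. (Such a map is taken up to isotopy, so it is given by its values on leaves and inner vertices; the edge of $F$ from $u$ to $v$ is mapped to the directed path in $G$ from the image of $u$ to the image of $v$, and injectivity on a tree means that distinct vertices of the tree have distinct images and that the images of distinct edges of the tree have no edge of $G$ in common.) Its least element $\hat 0$ is the forest without inner vertices. Let $T$ be a tree on $I$. Then the interval $[\hat 0,T]$ of $\operatorname{For}(I)$ is a lattice and is graded (for each $x$, all saturated chains from $\hat 0$ to $x$ have the same length, $\operatorname{rk}(x)$), and its characteristic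 polynomial $$\chi_{[\hat 0,T]}(t)=\sum_{y\in[\hat 0,T]}\mu(\hat 0,y)\,t^{\operatorname{rk}(T)-\operatorname{rk}(y)},$$ where $\mu$ is the Möbius function of $[\hat 0,T]$, is $$\chi_{[\hat 0,T]}(t)=\prod_{v\in\mathcal V(T)}\bigl(t-e(v)\bigr)\in\mathbb Z[t],$$ where $e(v)$ is the number of left ancestor leaves of $v$ times the number of right ancestor leaves of $v$, that is, the product of the numbers of ancestor leaves of the two children of $v$. -/

import Mathlib

/-- A forest of leaf-labeled rooted binary trees with leaf label set `I`, up to label-preserving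
isomorphism and not considered as planar. A vertex (leaf or inner vertex) is recorded by the
nonempty set of (labels of) its ancestor leaves: two different vertices have different sets of
ancestor leaves, and `v` lies on the path from `u` to the root if and only if `u ⊆ v`.
The leaf labeled `i` is `{i}`, and every inner vertex has exactly two children. -/
@[ext]
structure BinForest (I : Type*) [DecidableEq I] where
  /-- the vertices: leaves and inner vertices -/
  verts : Finset (Finset I)
  nonempty_of_mem : ∀ A ∈ verts, A.Nonempty
  leaf_mem : ∀ i : I, {i} ∈ verts
  laminar : ∀ A ∈ verts, ∀ B ∈ verts, A ⊆ B ∨ B ⊆ A ∨ Disjoint A B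
  binary : ∀ A ∈ verts, 1 < A.card → ∃ B ∈ verts, ∃ C ∈ verts, Disjoint B C ∧ B ∪ C = A

namespace BinForest

variable {I : Type*} [DecidableEq I]

/-- The vertices (leaves and inner vertices) of a forest, ordered towards the root: `u ≤ v` if and
only if `v` is on the path from `u` to the root. An edge from `u` to the next vertex `v` in the
direction of the root is a covering pair `u ⋖ v`. -/
abbrev Vertex (F : BinForest I) : Type _ := {A : Finset I // A ∈ F.verts}

/-- The leaf labeled `i`. -/
def leaf (F : BinForest I) (i : I) : F.Vertex := ⟨{i}, F.leaf_mem i⟩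

/-- Inner vertices are the vertices that are not leaves. -/
def IsInner (F : BinForest I) (v : F.Vertex) : Prop := ∀ i, v ≠ F.leaf i

/-- Two vertices are in the same tree of `F` if some vertex is on both of their paths
to the root. -/
def SameTree (F : BinForest I) (u v : F.Vertex) : Prop := ∃ w : F.Vertex, u ≤ w ∧ v ≤ w

/-- A forest is a tree if some vertex has all elements of the label set as ancestor leaves. -/
def IsTree [Fintype I] (F : BinForest I) : Prop := Finset.univ ∈ F.verts

open Classical in
/-- The finite set of inner vertices. -/
noncomputable def innerVerts (F : BinForest I) : Finset F.Vertex :=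
  Finset.univ.filter F.IsInner

open Classical in
/-- The finite set of children of a vertex: the left and the right one if it is inner. -/
noncomputable def children (F : BinForest I) (v : F.Vertex) : Finset F.Vertex :=
  Finset.univ.filter (fun u => u ⋖ v)

open Classical in
/-- The ancestor leaves of a vertex: the leaves whose path to the root goes through it. -/
noncomputable def ancestorLeaves [Fintype I] (F : BinForest I) (v : F.Vertex) : Finset I :=
  Finset.univ.filter (fun i => F.leaf i ≤ v)

/-- `e v` is the number of left ancestor leaves of `v` times the number of right ancestor leaves
of `v`, that is, the product over the two children of `v` of their numbers of ancestor leaves. -/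
noncomputable def e [Fintype I] (F : BinForest I) (v : F.Vertex) : ℕ :=
  ∏ u ∈ F.children v, (F.ancestorLeaves u).card

/-- The action on vertices of a topological map from `F` to `G` as in the definition of the order
on forests. Such a map is determined up to isotopy by this action: the edge from `u` to `v` in `F`
is mapped to the path from `φ u` to `φ v` in `G`, whose edges are the edges of `G` that leave a
vertex `w` with `φ u ≤ w < φ v` in the direction of the root. -/
structure IsForestMap (F G : BinForest I) (φ : F.Vertex → G.Vertex) : Prop where
  /-- the map is increasing with respect to orientation towards the root -/
  increasing : ∀ u v, u ≤ v → φ u ≤ φ v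
  /-- it maps inner vertices to inner vertices ... -/
  inner : ∀ v, F.IsInner v → G.IsInner (φ v)
  /-- ... injectively -/
  inner_injective : ∀ u v, F.IsInner u → F.IsInner v → φ u = φ v → u = v
  /-- it restricts to the identity of `I` on leaves -/
  map_leaf : ∀ i, φ (F.leaf i) = G.leaf i
  /-- its restriction to each tree of `F` is injective, on vertices ... -/
  tree_injective : ∀ u u', F.SameTree u u' → φ u = φ u' → u = u'
  /-- ... and on edges: the images of two different edges of a tree have no edge of `G` in
  common -/
  tree_edge_injective : ∀ u v u' v', u ⋖ v → u' ⋖ v' → F.SameTree u u' →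
    ∀ w, φ u ≤ w → w < φ v → φ u' ≤ w → w < φ v' → u = u'

theorem Vertex.injective_of_isForestMap {F G : BinForest I} {φ : F.Vertex → G.Vertex}
    (h : IsForestMap F G φ) : Function.Injective φ := by
  have leaf_inj : ∀ i j, G.leaf i = G.leaf j → i = j := fun i j hij => by
    simpa [leaf] using hij
  intro u v huv
  by_cases hu : F.IsInner u
  · by_cases hv : F.IsInner v
    · exact h.inner_injective u v hu hv huv
    · simp only [IsInner, not_forall, not_not] at hv
      obtain ⟨j, rfl⟩ := hv
      exact absurd (huv.trans (h.map_leaf j)) (h.inner u hu j)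
  · simp only [IsInner, not_forall, not_not] at hu
    obtain ⟨i, rfl⟩ := hu
    by_cases hv : F.IsInner v
    · exact absurd (huv.symm.trans (h.map_leaf i)) (h.inner v hv i)
    · simp only [IsInner, not_forall, not_not] at hv
      obtain ⟨j, rfl⟩ := hv
      rw [h.map_leaf, h.map_leaf] at huv
      rw [leaf_inj i j huv]

theorem subset_of_isForestMap {F G : BinForest I} {φ : F.Vertex → G.Vertex}
    (h : IsForestMap F G φ) (v : F.Vertex) : v.1 ⊆ (φ v).1 := by
  intro i hi
  have h1 : F.leaf i ≤ v := by
    change ({i} : Finset I) ⊆ v.1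
    simpa using hi
  have h2 := h.increasing _ _ h1
  rw [h.map_leaf] at h2
  have h3 : ({i} : Finset I) ⊆ (φ v).1 := h2
  simpa using h3

theorem isForestMap_id (F : BinForest I) : IsForestMap F F id where
  increasing _ _ h := h
  inner _ h := h
  inner_injective _ _ _ _ h := h
  map_leaf _ := rfl
  tree_injective _ _ _ h := h
  tree_edge_injective u v u' v' h h' _ w h1 h2 h3 h4 := by
    have e1 : u = w := by
      by_contra hne
      exact h.2 (lt_of_le_of_ne h1 hne) h2
    have e2 : u' = w := by
      by_contra hne
      exact h'.2 (lt_of_le_of_ne h3 hne) h4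
    exact e1.trans e2.symm

/-- On the path from `a` to `b`, every point lies on an edge (stated along a monotone map `ψ`). -/
theorem exists_edge {G H : BinForest I} (ψ : G.Vertex → H.Vertex) (hψ : IsForestMap G H ψ)
    (w : H.Vertex) (a b : G.Vertex) (hab : a ≤ b) (h1 : ψ a ≤ w) (h2 : w < ψ b) :
    ∃ c d, a ≤ c ∧ c ⋖ d ∧ d ≤ b ∧ ψ c ≤ w ∧ w < ψ d := by
  classical
  -- chains above a vertex are totally ordered
  have tot : ∀ x y : G.Vertex, a ≤ x → a ≤ y → x ≤ y ∨ y ≤ x := by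
    intro x y hx hy
    rcases G.laminar x.1 x.2 y.1 y.2 with h | h | h
    · exact Or.inl h
    · exact Or.inr h
    · exfalso
      obtain ⟨i, hi⟩ := G.nonempty_of_mem a.1 a.2
      have hx' : a.1 ⊆ x.1 := hx
      have hy' : a.1 ⊆ y.1 := hy
      exact Finset.disjoint_left.1 h (hx' hi) (hy' hi)
  let S : Finset G.Vertex := Finset.univ.filter (fun c => a ≤ c ∧ c ≤ b ∧ ψ c ≤ w)
  obtain ⟨c, hc⟩ := S.exists_maximal ⟨a, by simp [S, hab, h1]⟩
  have hcS : a ≤ c ∧ c ≤ b ∧ ψ c ≤ w := by simpa [S] using hc.1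
  let U : Finset G.Vertex := Finset.univ.filter (fun d => c < d ∧ d ≤ b)
  have hcb : c < b := lt_of_le_of_ne hcS.2.1 (by
    rintro rfl
    exact absurd hcS.2.2 (not_le_of_gt h2))
  obtain ⟨d, hd⟩ := U.exists_minimal ⟨b, by simp [U, hcb]⟩
  have hdU : c < d ∧ d ≤ b := by simpa [U] using hd.1
  refine ⟨c, d, hcS.1, ⟨hdU.1, ?_⟩, hdU.2, hcS.2.2, ?_⟩
  · intro x hcx hxd
    have : x ∈ U := by simp [U, hcx, hxd.le.trans hdU.2]
    exact absurd (hd.2 this hxd.le) (not_le_of_gt hxd)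
  · have hnot : ¬ ψ d ≤ w := by
      intro hdw
      have : d ∈ S := by simp [S, hcS.1.trans hdU.1.le, hdU.2, hdw]
      exact absurd (hc.2 this hdU.1.le) (not_le_of_gt hdU.1)
    have htot : ψ d ≤ w ∨ w ≤ ψ d := by
      rcases H.laminar (ψ d).1 (ψ d).2 w.1 w.2 with h | h | h
      · exact Or.inl h
      · exact Or.inr h
      · exfalso
        obtain ⟨i, hi⟩ := H.nonempty_of_mem (ψ a).1 (ψ a).2
        have hx' : (ψ a).1 ⊆ (ψ d).1 := hψ.increasing _ _ (hcS.1.trans hdU.1.le)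
        have hy' : (ψ a).1 ⊆ w.1 := h1
        exact Finset.disjoint_left.1 h (hx' hi) (hy' hi)
    rcases htot with h | h
    · exact absurd h hnot
    · exact lt_of_le_of_ne h (fun heq => hnot heq.ge)

theorem IsForestMap.comp {F G H : BinForest I} {φ : F.Vertex → G.Vertex}
    {ψ : G.Vertex → H.Vertex} (hψ : IsForestMap G H ψ) (hφ : IsForestMap F G φ) :
    IsForestMap F H (ψ ∘ φ) where
  increasing u v h := hψ.increasing _ _ (hφ.increasing u v h)
  inner v h := hψ.inner _ (hφ.inner v h)
  inner_injective u v hu hv h :=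
    hφ.inner_injective u v hu hv (hψ.inner_injective _ _ (hφ.inner u hu) (hφ.inner v hv) h)
  map_leaf i := by simp [hφ.map_leaf, hψ.map_leaf]
  tree_injective u u' _ h :=
    Vertex.injective_of_isForestMap hφ (Vertex.injective_of_isForestMap hψ h)
  tree_edge_injective u v u' v' h h' hs w h1 h2 h3 h4 := by
    obtain ⟨c, d, hc, hcd, hd, hcw, hwd⟩ :=
      exists_edge ψ hψ w (φ u) (φ v) (hφ.increasing _ _ h.le) h1 h2
    obtain ⟨c', d', hc', hcd', hd', hcw', hwd'⟩ :=
      exists_edge ψ hψ w (φ u') (φ v') (hφ.increasing _ _ h'.le) h3 h4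
    obtain ⟨r, hr, hr'⟩ := hs
    -- the edges leaving `c` and `c'` are in the same tree of `G`
    have key : G.SameTree c c' := by
      have aux : ∀ x y z : G.Vertex, x ≤ y → x ≤ z → y ≤ z ∨ z ≤ y := by
        intro x y z hy hz
        rcases G.laminar y.1 y.2 z.1 z.2 with h | h | h
        · exact Or.inl h
        · exact Or.inr h
        · exfalso
          obtain ⟨i, hi⟩ := G.nonempty_of_mem x.1 x.2
          have hy' : x.1 ⊆ y.1 := hy
          have hz' : x.1 ⊆ z.1 := hz
          exact Finset.disjoint_left.1 h (hy' hi) (hz' hi)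
      rcases aux _ _ _ hc (hφ.increasing _ _ hr) with k | k
      · rcases aux _ _ _ hc' (hφ.increasing _ _ hr') with k' | k'
        · exact ⟨_, k, k'⟩
        · exact ⟨c', k.trans k', le_rfl⟩
      · rcases aux _ _ _ hc' (hφ.increasing _ _ hr') with k' | k'
        · exact ⟨c, le_rfl, k'.trans k⟩
        · rcases aux _ _ _ k k' with q | q
          · exact ⟨c', q, le_rfl⟩
          · exact ⟨c, le_rfl, q⟩
    have hcc : c = c' := hψ.tree_edge_injective c d c' d' hcd hcd' key w hcw hwd hcw' hwd'
    subst hcc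
    exact hφ.tree_edge_injective u v u' v' h h' ⟨r, hr, hr'⟩ c hc (hcd.lt.trans_le hd) hc'
      (hcd'.lt.trans_le hd')

theorem verts_subset_of_maps {F G : BinForest I} {φ : F.Vertex → G.Vertex}
    {ψ : G.Vertex → F.Vertex} (hφ : IsForestMap F G φ) (hψ : IsForestMap G F ψ) :
    F.verts ⊆ G.verts := by
  have iφ := Vertex.injective_of_isForestMap hφ
  have iψ := Vertex.injective_of_isForestMap hψ
  have hcard : Fintype.card F.Vertex = Fintype.card G.Vertex :=
    le_antisymm (Fintype.card_le_of_injective φ iφ) (Fintype.card_le_of_injective ψ iψ)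
  have bφ : Function.Bijective φ := (Fintype.bijective_iff_injective_and_card φ).2 ⟨iφ, hcard⟩
  have bψ : Function.Bijective ψ := (Fintype.bijective_iff_injective_and_card ψ).2 ⟨iψ, hcard.symm⟩
  have s1 : ∑ v : F.Vertex, (φ v).1.card = ∑ w : G.Vertex, w.1.card :=
    bφ.sum_comp (fun w : G.Vertex => w.1.card)
  have s2 : ∑ w : G.Vertex, (ψ w).1.card = ∑ v : F.Vertex, v.1.card :=
    bψ.sum_comp (fun v : F.Vertex => v.1.card)
  have l2 : ∑ w : G.Vertex, w.1.card ≤ ∑ w : G.Vertex, (ψ w).1.card :=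
    Finset.sum_le_sum fun w _ => Finset.card_le_card (subset_of_isForestMap hψ w)
  have l1 : ∀ v ∈ (Finset.univ : Finset F.Vertex), v.1.card ≤ (φ v).1.card :=
    fun v _ => Finset.card_le_card (subset_of_isForestMap hφ v)
  have hsum : ∑ v : F.Vertex, v.1.card = ∑ v : F.Vertex, (φ v).1.card :=
    le_antisymm (Finset.sum_le_sum l1) (by omega)
  intro A hA
  have h := (Finset.sum_eq_sum_iff_of_le l1).1 hsum ⟨A, hA⟩ (Finset.mem_univ _)
  have hA' : A = (φ ⟨A, hA⟩).1 :=
    Finset.eq_of_subset_of_card_le (subset_of_isForestMap hφ ⟨A, hA⟩) h.ge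
  rw [hA']
  exact (φ ⟨A, hA⟩).2

/-- The poset of forests on `I`: `F ≤ G` if there is a map from `F` to `G` that is increasing with
respect to orientation towards the root, maps inner vertices to inner vertices injectively, is the
identity on leaves and is injective on each tree of `F`. -/
instance : PartialOrder (BinForest I) where
  le F G := ∃ φ : F.Vertex → G.Vertex, IsForestMap F G φ
  le_refl F := ⟨id, isForestMap_id F⟩
  le_trans _ _ _ := fun ⟨φ, hφ⟩ ⟨ψ, hψ⟩ => ⟨ψ ∘ φ, hψ.comp hφ⟩
  le_antisymm F G := fun ⟨_, hφ⟩ ⟨_, hψ⟩ =>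
    BinForest.ext (Finset.Subset.antisymm (verts_subset_of_maps hφ hψ)
      (verts_subset_of_maps hψ hφ))

/-- The forest without inner vertices is the least element `0̂`. -/
instance [Fintype I] : OrderBot (BinForest I) where
  bot :=
    { verts := Finset.univ.image (fun i : I => {i})
      nonempty_of_mem := by simp
      leaf_mem := by simp
      laminar := by
        intro A hA B hB
        simp only [Finset.mem_image, Finset.mem_univ, true_and] at hA hB
        obtain ⟨i, rfl⟩ := hA
        obtain ⟨j, rfl⟩ := hB
        by_cases h : i = j
        · exact Or.inl (by simp [h])
        · exact Or.inr (Or.inr (by simp [h]))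
      binary := by
        intro A hA h
        simp only [Finset.mem_image, Finset.mem_univ, true_and] at hA
        obtain ⟨i, rfl⟩ := hA
        simp at h }
  bot_le F := by
    refine ⟨fun v => ⟨v.1, ?_⟩, ?_⟩
    · obtain ⟨A, hA⟩ := v
      simp only [Finset.mem_image, Finset.mem_univ, true_and] at hA
      obtain ⟨i, rfl⟩ := hA
      exact F.leaf_mem i
    · have no_edge : ∀ A ∈ Finset.univ.image (fun i : I => ({i} : Finset I)),
          ∀ B ∈ Finset.univ.image (fun i : I => ({i} : Finset I)), ¬ A ⊂ B := by
        intro A hA B hB h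
        simp only [Finset.mem_image, Finset.mem_univ, true_and] at hA hB
        obtain ⟨i, rfl⟩ := hA
        obtain ⟨j, rfl⟩ := hB
        have := Finset.card_lt_card h
        simp at this
      refine ⟨fun _ _ h => h, ?_, ?_, fun _ => rfl, ?_, ?_⟩
      · intro v hv i h
        have h' : v.1 = {i} := (Subtype.ext_iff.1 h :)
        exact hv i (Subtype.ext h')
      · intro u v _ _ h
        have h' : u.1 = v.1 := (Subtype.ext_iff.1 h :)
        exact Subtype.ext h'
      · intro u v _ h
        have h' : u.1 = v.1 := (Subtype.ext_iff.1 h :)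
        exact Subtype.ext h'
      · intro u v u' v' h
        exact absurd h.lt (no_edge u.1 u.2 v.1 v.2)

noncomputable instance [Fintype I] : Fintype (BinForest I) :=
  Fintype.ofInjective BinForest.verts (fun _ _ h => BinForest.ext h)

instance [Fintype I] (T : BinForest I) : Fact (⊥ ≤ T) := ⟨bot_le⟩

end BinForest

section Poset

/-- Every two elements have a join and a meet. -/
def IsLatticeOrder (P : Type*) [PartialOrder P] : Prop :=
  ∀ x y : P, (∃ z, IsLUB {x, y} z) ∧ (∃ z, IsGLB {x, y} z)

/-- The rank of an element: the length of the longest chains from the least element to it. -/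
noncomputable def posetRank {P : Type*} [PartialOrder P] (x : P) : ℕ := (Order.height x).toNat

/-- A poset is graded if, for every `x`, all saturated chains from the least element to `x` have
the same length, which is then the rank of `x`. -/
def IsGradedPoset (P : Type*) [PartialOrder P] [OrderBot P] : Prop :=
  ∀ (x : P) (c : RelSeries {p : P × P | p.1 ⋖ p.2}), c.head = ⊥ → c.last = x →
    c.length = posetRank x

open Classical Polynomial in
/-- The characteristic polynomial `∑ y, μ(0̂, y) t ^ (n - rk y)` of a finite bounded graded poset
of rank `n = rk 1̂`. -/
noncomputable def charPolynomial (P : Type*) [PartialOrder P] [BoundedOrder P] [Finite P] :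
    ℤ[X] :=
  letI : Fintype P := Fintype.ofFinite P
  letI : LocallyFiniteOrder P := Fintype.toLocallyFiniteOrder
  ∑ y : P, C (IncidenceAlgebra.mu ℤ (⊥ : P) y) * X ^ (posetRank (⊤ : P) - posetRank y)

end Poset

/-! A forest below `T` is determined by the partition of the leaves into its trees, since each tree
is the one induced by `T` on its block. Edge-injectivity makes the map send the vertex where two
leaves meet in the forest to their meeting point in `T`, so injectivity on inner vertices says that
no inner vertex of `T` is a meeting point for two different blocks. Conversely every such
(admissible) partition arises, and the order becomes refinement (`iccOrderIso`). Admissible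
partitions are closed under intersection, which gives meets; a finite poset with meets and a top is
a lattice.

The rank of a partition `r` is the size of `cross r`, the set of vertices where equivalent leaves
meet. Uniting the classes of two leaves that meet outside `cross r` preserves admissibility and adds
exactly that one vertex (`Admissible.cross_uniteClasses`). Hence one pair of leaves chosen at each
vertex of a set `S` generates an admissible partition with crossing set `S`, and it is the only one
with this crossing set that contains the chosen pairs.

Let `c y v` be the number of `y`-equivalent pairs meeting at `v`. Counting the choices gives that
the sum of `∏ v ∈ S, c x v` over all `x ≤ y` crossing exactly at `S` is `∏ v ∈ S, c y v`
(`sum_prod_card_crossPairs`). Expanding a product over `cross y` then shows that the candidate `μ(x)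
= ∏ v ∈ cross x, -c x v` satisfies `∑ x ≤ y, μ(x) t ^ (rk y - rk x) = ∏ v ∈ cross y, (t - c y v)`.
At `t = 1` this vanishes for `y ≠ ⊥`, because `c y v = 1` at a minimal crossing vertex; so the
candidate is the Möbius function. At the top, `c` is `e`, and the same identity is the claim. -/

namespace BinForest

/-! ### Meeting points of leaves in a tree -/

variable {I : Type*} [DecidableEq I]

theorem exists_least_vertex (F : BinForest I) {A : Finset I} (hA : A.Nonempty)
    (h : ∃ v ∈ F.verts, A ⊆ v) :
    ∃ v ∈ F.verts, A ⊆ v ∧ ∀ w ∈ F.verts, A ⊆ w → v ⊆ w := by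
  obtain ⟨v, hv, hmin⟩ := (F.verts.filter (A ⊆ ·)).exists_min_image Finset.card
    (by obtain ⟨v, hv, hAv⟩ := h; exact ⟨v, by simp [hv, hAv]⟩)
  rw [Finset.mem_filter] at hv
  refine ⟨v, hv.1, hv.2, fun w hw hAw => ?_⟩
  rcases F.laminar v hv.1 w hw with h | h | h
  · exact h
  · exact (Finset.eq_of_subset_of_card_le h (hmin w (by simp [hw, hAw]))).ge
  · obtain ⟨i, hi⟩ := hA
    exact absurd (hAw hi) (Finset.disjoint_left.1 h (hv.2 hi))

theorem subset_or_subset_of_mem (F : BinForest I) {v w : Finset I} (hv : v ∈ F.verts)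
    (hw : w ∈ F.verts) {i : I} (hiv : i ∈ v) (hiw : i ∈ w) : v ⊆ w ∨ w ⊆ v := by
  rcases F.laminar v hv w hw with h | h | h
  · exact Or.inl h
  · exact Or.inr h
  · exact absurd hiw (Finset.disjoint_left.1 h hiv)

theorem subset_child_of_ssubset (F : BinForest I) {v w B C : Finset I} (hw : w ∈ F.verts)
    (hB : B ∈ F.verts) (hC : C ∈ F.verts) (hv : B ∪ C = v) (hwv : w ⊂ v) :
    w ⊆ B ∨ w ⊆ C := by
  subst hv
  rcases F.laminar w hw B hB with h | h | h
  · exact Or.inl h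
  · rcases F.laminar w hw C hC with h' | h' | h'
    · exact Or.inr h'
    · exact absurd (Finset.union_subset h h') hwv.2
    · exact Or.inl (h'.left_le_of_le_sup_right hwv.1)
  · exact Or.inr (h.left_le_of_le_sup_left hwv.1)

open Classical in
/-- The first of the two children of the inner vertex `v`, in an arbitrary order. -/
noncomputable def left (F : BinForest I) (v : Finset I) : Finset I :=
  if h : v ∈ F.verts ∧ 1 < v.card then (F.binary v h.1 h.2).choose else ∅

theorem left_spec (F : BinForest I) {v : Finset I} (hv : v ∈ F.verts) (h : 1 < v.card) :
    F.left v ∈ F.verts ∧ v \ F.left v ∈ F.verts ∧ F.left v ⊆ v := by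
  have hl : F.left v = (F.binary v hv h).choose := by simp [left, hv, h]
  obtain ⟨hB, C, hC, hd, hu⟩ := (F.binary v hv h).choose_spec
  rw [← hl] at hB hd hu
  have : v \ F.left v = C := by
    conv_lhs => enter [1]; rw [← hu]
    rw [Finset.union_sdiff_left, Finset.sdiff_eq_self_of_disjoint hd.symm]
  refine ⟨hB, this ▸ hC, ?_⟩
  conv_rhs => rw [← hu]
  exact Finset.subset_union_left

theorem subset_left_or_subset_sdiff (F : BinForest I) {v w : Finset I} (hv : v ∈ F.verts)
    (hw : w ∈ F.verts) (hwv : w ⊂ v) : w ⊆ F.left v ∨ w ⊆ v \ F.left v := by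
  have h : 1 < v.card :=
    Nat.lt_of_le_of_lt (Finset.card_pos.2 (F.nonempty_of_mem w hw)) (Finset.card_lt_card hwv)
  obtain ⟨hl, hr, hs⟩ := F.left_spec hv h
  exact F.subset_child_of_ssubset hw hl hr
    (Finset.union_sdiff_of_subset hs) hwv

section Tree

variable [Fintype I]

/-- The intersection of all vertices that contain `A`: for a nonempty set `A` of leaves of a tree,
the last common vertex of their paths to the root. -/
def lca (T : BinForest I) (A : Finset I) : Finset I := (T.verts.filter (A ⊆ ·)).inf id

/-- The vertex of a tree where the paths from `i` and `j` to the root meet. -/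
def join (T : BinForest I) (i j : I) : Finset I := T.lca {i, j}

variable {T : BinForest I}

theorem subset_lca (A : Finset I) : A ⊆ T.lca A :=
  Finset.le_inf fun _ hw => (Finset.mem_filter.1 hw).2

theorem lca_subset {A w : Finset I} (hw : w ∈ T.verts) (h : A ⊆ w) : T.lca A ⊆ w :=
  Finset.inf_le (f := id) (Finset.mem_filter.2 ⟨hw, h⟩)

theorem lca_mem (hT : T.IsTree) {A : Finset I} (hA : A.Nonempty) : T.lca A ∈ T.verts := by
  obtain ⟨v, hv, hAv, hl⟩ := T.exists_least_vertex hA ⟨_, hT, Finset.subset_univ A⟩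
  have : T.lca A = v := Finset.Subset.antisymm (lca_subset hv hAv)
    (Finset.le_inf fun w hw => hl w (Finset.mem_filter.1 hw).1 (Finset.mem_filter.1 hw).2)
  exact this ▸ hv

theorem lca_mono {A B : Finset I} (h : A ⊆ B) : T.lca A ⊆ T.lca B :=
  Finset.inf_mono fun w hw => by
    rw [Finset.mem_filter] at hw ⊢
    exact ⟨hw.1, h.trans hw.2⟩

theorem lca_singleton (i : I) : T.lca {i} = {i} :=
  Finset.Subset.antisymm (lca_subset (T.leaf_mem i) subset_rfl) (subset_lca _)

theorem join_comm (i j : I) : T.join i j = T.join j i := by rw [join, join, Finset.pair_comm]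

theorem left_mem_join (i j : I) : i ∈ T.join i j := subset_lca _ (by simp)

theorem right_mem_join (i j : I) : j ∈ T.join i j := subset_lca _ (by simp)

theorem join_mem (hT : T.IsTree) (i j : I) : T.join i j ∈ T.verts := lca_mem hT (by simp)

theorem join_subset {i j : I} {w : Finset I} (hw : w ∈ T.verts) (hi : i ∈ w) (hj : j ∈ w) :
    T.join i j ⊆ w :=
  lca_subset hw (by simp [Finset.insert_subset_iff, hi, hj])

theorem one_lt_card_join {i j : I} (h : i ≠ j) : 1 < (T.join i j).card :=
  Finset.one_lt_card.2 ⟨i, left_mem_join i j, j, right_mem_join i j, h⟩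

/-- Joins behave like an ultrametric: of the three joins of `i`, `j`, `k`, the two largest coincide.
-/
theorem join_eq_of_ssubset (hT : T.IsTree) {i j k : I} (h : T.join i j ⊂ T.join j k) :
    T.join i k = T.join j k := by
  apply Finset.Subset.antisymm
  · exact join_subset (join_mem hT j k) (h.1 (left_mem_join i j)) (right_mem_join j k)
  · rcases T.subset_or_subset_of_mem (join_mem hT i k) (join_mem hT i j) (left_mem_join i k)
      (left_mem_join i j) with h' | h'
    · exact absurd (join_subset (join_mem hT i j) (right_mem_join i j)
        (h' (right_mem_join i k))) h.2
    · exact join_subset (join_mem hT i k) (h' (right_mem_join i j)) (right_mem_join i k)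

theorem join_eq_or_eq_of_ne (hT : T.IsTree) {i j k : I} (h : T.join i j ≠ T.join j k) :
    T.join i k = T.join i j ∨ T.join i k = T.join j k := by
  rcases T.subset_or_subset_of_mem (join_mem hT i j) (join_mem hT j k) (right_mem_join i j)
      (left_mem_join j k) with h' | h'
  · exact Or.inr (join_eq_of_ssubset hT (lt_of_le_of_ne h' h))
  · left
    rw [join_comm i k, join_comm i j]
    apply join_eq_of_ssubset hT
    rw [join_comm k j, join_comm j i]
    exact lt_of_le_of_ne h' h.symm

/-- The pairs of leaves that meet in an inner vertex are those with a leaf on either side. -/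
theorem join_eq_iff (hT : T.IsTree) {v : Finset I} (hv : v ∈ T.verts) (hc : 1 < v.card) {i j : I} :
    T.join i j = v ↔
      (i ∈ T.left v ∧ j ∈ v \ T.left v) ∨ (j ∈ T.left v ∧ i ∈ v \ T.left v) := by
  obtain ⟨hl, hr, hs⟩ := T.left_spec hv hc
  have hnl : ¬ v ⊆ T.left v := fun h => by
    obtain ⟨x, hx⟩ := T.nonempty_of_mem _ hr
    exact (Finset.mem_sdiff.1 hx).2 (h (Finset.mem_sdiff.1 hx).1)
  have hnr : ¬ v ⊆ v \ T.left v := fun h => by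
    obtain ⟨x, hx⟩ := T.nonempty_of_mem _ hl
    exact (Finset.mem_sdiff.1 (h (hs hx))).2 hx
  constructor
  · intro h
    have hi : i ∈ v := h ▸ left_mem_join i j
    have hj : j ∈ v := h ▸ right_mem_join i j
    by_cases hil : i ∈ T.left v <;> by_cases hjl : j ∈ T.left v
    · exact absurd (h.ge.trans (join_subset hl hil hjl)) hnl
    · exact Or.inl ⟨hil, by simp [hj, hjl]⟩
    · exact Or.inr ⟨hjl, by simp [hi, hil]⟩
    · exact absurd (h.ge.trans (join_subset hr (by simp [hi, hil]) (by simp [hj, hjl]))) hnr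
  · intro h
    have hi : i ∈ v := by
      rcases h with h | h
      exacts [hs h.1, (Finset.mem_sdiff.1 h.2).1]
    have hj : j ∈ v := by
      rcases h with h | h
      exacts [(Finset.mem_sdiff.1 h.2).1, hs h.1]
    by_contra hne
    rcases T.subset_left_or_subset_sdiff hv (join_mem hT i j)
      (lt_of_le_of_ne (join_subset hv hi hj) hne) with h' | h'
    · have h1 := h' (left_mem_join i j)
      have h2 := h' (right_mem_join i j)
      simp only [Finset.mem_sdiff] at h
      tauto
    · have h1 := h' (left_mem_join i j)
      have h2 := h' (right_mem_join i j)
      simp only [Finset.mem_sdiff] at h h1 h2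
      tauto

theorem join_ssubset_of_side (hT : T.IsTree) {v : Finset I} (hv : v ∈ T.verts) (hc : 1 < v.card)
    {i k : I} (hi : i ∈ v) (hk : k ∈ v) (h : i ∈ T.left v ↔ k ∈ T.left v) : T.join i k ⊂ v := by
  refine lt_of_le_of_ne (join_subset hv hi hk) fun h' => ?_
  rw [join_eq_iff hT hv hc] at h'
  simp only [Finset.mem_sdiff] at h'
  tauto

/-- Both pairs have one leaf on each side of the common vertex; leaves on the same side meet
strictly below it. This is the descent step for induction on the size of the join. -/
theorem join_ssubset_of_join_eq (hT : T.IsTree) {i j k l : I} (hij : i ≠ j)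
    (h : T.join i j = T.join k l) :
    (T.join i k ⊂ T.join i j ∧ T.join j l ⊂ T.join i j) ∨
      (T.join i l ⊂ T.join i j ∧ T.join j k ⊂ T.join i j) := by
  have hv := join_mem hT i j
  have hc := one_lt_card_join (T := T) hij
  have hi := left_mem_join (T := T) i j
  have hj := right_mem_join (T := T) i j
  have hk : k ∈ T.join i j := h ▸ left_mem_join k l
  have hl : l ∈ T.join i j := h ▸ right_mem_join k l
  have h1 := (join_eq_iff hT hv hc).1 rfl
  have h2 := (join_eq_iff hT hv hc).1 h.symm
  simp only [Finset.mem_sdiff] at h1 h2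
  by_cases hs : i ∈ T.left (T.join i j) ↔ k ∈ T.left (T.join i j)
  · exact Or.inl ⟨join_ssubset_of_side hT hv hc hi hk hs,
      join_ssubset_of_side hT hv hc hj hl (by tauto)⟩
  · exact Or.inr ⟨join_ssubset_of_side hT hv hc hi hl (by tauto),
      join_ssubset_of_side hT hv hc hj hk (by tauto)⟩

/-- By minimality of the least vertex above `A`, neither of its children contains `A`, so `A` has
leaves on both sides. -/
theorem exists_join_eq_lca (hT : T.IsTree) {A : Finset I} (hA : 1 < A.card) :
    ∃ i ∈ A, ∃ j ∈ A, i ≠ j ∧ T.join i j = T.lca A := by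
  have hne : A.Nonempty := Finset.card_pos.1 (by omega)
  have hv := lca_mem hT hne
  have hc : 1 < (T.lca A).card := hA.trans_le (Finset.card_le_card (subset_lca A))
  obtain ⟨hl, hr, hs⟩ := T.left_spec hv hc
  have h1 : ∃ i ∈ A, i ∈ T.left (T.lca A) := by
    by_contra! h
    obtain ⟨x, hx⟩ := T.nonempty_of_mem _ hl
    have := lca_subset (A := A) hr fun y hy => Finset.mem_sdiff.2 ⟨subset_lca A hy, h y hy⟩
    exact (Finset.mem_sdiff.1 (this (hs hx))).2 hx
  have h2 : ∃ j ∈ A, j ∉ T.left (T.lca A) := by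
    by_contra! h
    obtain ⟨x, hx⟩ := T.nonempty_of_mem _ hr
    exact (Finset.mem_sdiff.1 hx).2 (lca_subset (A := A) hl h (Finset.mem_sdiff.1 hx).1)
  obtain ⟨i, hi, hil⟩ := h1
  obtain ⟨j, hj, hjl⟩ := h2
  exact ⟨i, hi, j, hj, fun h => hjl (h ▸ hil), (join_eq_iff hT hv hc).2
    (Or.inl ⟨hil, Finset.mem_sdiff.2 ⟨subset_lca A hj, hjl⟩⟩)⟩

end Tree

end BinForest

/-! ### Admissible partitions: generation, counting and Möbius function -/

namespace BinForest

variable {I : Type*}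

/-- The equivalence relation that arises from `r` by uniting the classes of `i` and `j`. -/
def uniteClasses (r : Setoid I) (i j : I) : Setoid I where
  r a b := r a b ∨ (r a i ∧ r j b) ∨ (r a j ∧ r i b)
  iseqv :=
    { refl := fun a => Or.inl (r.refl a)
      symm := by
        rintro a b (h | ⟨h, h'⟩ | ⟨h, h'⟩)
        · exact Or.inl (r.symm h)
        · exact Or.inr (Or.inr ⟨r.symm h', r.symm h⟩)
        · exact Or.inr (Or.inl ⟨r.symm h', r.symm h⟩)
      trans := by
        rintro a b c (h | ⟨h, h'⟩ | ⟨h, h'⟩) (k | ⟨k, k'⟩ | ⟨k, k'⟩)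
        · exact Or.inl (r.trans h k)
        · exact Or.inr (Or.inl ⟨r.trans h k, k'⟩)
        · exact Or.inr (Or.inr ⟨r.trans h k, k'⟩)
        · exact Or.inr (Or.inl ⟨h, r.trans h' k⟩)
        · exact Or.inl (r.trans h (r.trans (r.symm (r.trans h' k)) k'))
        · exact Or.inl (r.trans h k')
        · exact Or.inr (Or.inr ⟨h, r.trans h' k⟩)
        · exact Or.inl (r.trans h k')
        · exact Or.inl (r.trans h (r.trans (r.symm (r.trans h' k)) k')) }

theorem le_uniteClasses (r : Setoid I) (i j : I) : r ≤ uniteClasses r i j := fun {_ _} h => Or.inl h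

theorem uniteClasses_rel (r : Setoid I) (i j : I) : uniteClasses r i j i j :=
  Or.inr (Or.inl ⟨r.refl i, r.refl j⟩)

theorem uniteClasses_le {r s : Setoid I} {i j : I} (h : r ≤ s) (hij : s i j) :
    uniteClasses r i j ≤ s := by
  rintro a b (h' | ⟨h1, h2⟩ | ⟨h1, h2⟩)
  · exact h h'
  · exact s.trans (h h1) (s.trans hij (h h2))
  · exact s.trans (h h1) (s.trans (s.symm hij) (h h2))

variable [DecidableEq I]

open Classical in
/-- The pairs of equivalent leaves that meet in `v`, with their first entry on the left. -/
noncomputable def crossPairs (T : BinForest I) (r : Setoid I) (v : Finset I) : Finset (I × I) :=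
  (T.left v ×ˢ (v \ T.left v)).filter fun p => r p.1 p.2

theorem mem_crossPairs {T : BinForest I} {r : Setoid I} {v : Finset I} {p : I × I} :
    p ∈ T.crossPairs r v ↔ p.1 ∈ T.left v ∧ p.2 ∈ v \ T.left v ∧ r p.1 p.2 := by
  simp [crossPairs, and_assoc]

theorem ne_of_mem_crossPairs {T : BinForest I} {r : Setoid I} {v : Finset I} {p : I × I}
    (h : p ∈ T.crossPairs r v) : p.1 ≠ p.2 := fun he =>
  (Finset.mem_sdiff.1 (mem_crossPairs.1 h).2.1).2 (he ▸ (mem_crossPairs.1 h).1)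

variable [Fintype I]

/-- A partition of the leaves of a tree, given as an equivalence relation, is admissible if every
inner vertex of the tree is the meeting point of pairs from at most one block. -/
def Admissible (T : BinForest I) (r : Setoid I) : Prop :=
  ∀ i j k l, r i j → r k l → i ≠ j → k ≠ l → T.join i j = T.join k l → r i k

/-- The admissible partitions, ordered by refinement. -/
abbrev AdmSetoid (T : BinForest I) : Type _ := {r : Setoid I // T.Admissible r}

noncomputable instance (T : BinForest I) : Fintype T.AdmSetoid :=
  haveI : Finite T.AdmSetoid := Finite.of_injective (fun r i j => r.1 i j) fun _ _ h =>
    Subtype.ext (Setoid.ext fun i j => iff_of_eq (congrFun (congrFun h i) j))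
  Fintype.ofFinite _

open Classical in
/-- The inner vertices of the tree that are meeting points of equivalent leaves. -/
noncomputable def cross (T : BinForest I) (r : Setoid I) : Finset (Finset I) :=
  Finset.univ.filter fun v => ∃ i j, i ≠ j ∧ r i j ∧ T.join i j = v

variable {T : BinForest I}

theorem mem_cross {r : Setoid I} {v : Finset I} :
    v ∈ T.cross r ↔ ∃ i j, i ≠ j ∧ r i j ∧ T.join i j = v := by simp [cross]

theorem cross_mono {r s : Setoid I} (h : r ≤ s) : T.cross r ⊆ T.cross s := fun v hv => by
  obtain ⟨i, j, hij, hr, hv⟩ := mem_cross.1 hv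
  exact mem_cross.2 ⟨i, j, hij, h hr, hv⟩

theorem admissible_bot : T.Admissible ⊥ := fun _ _ _ _ h _ hij => absurd h hij

theorem admissible_top : T.Admissible ⊤ := fun _ _ _ _ _ _ _ _ _ => trivial

theorem Admissible.inf {r s : Setoid I} (hr : T.Admissible r) (hs : T.Admissible s) :
    T.Admissible (r ⊓ s) := fun i j k l h h' hij hkl he =>
  ⟨hr i j k l h.1 h'.1 hij hkl he, hs i j k l h.2 h'.2 hij hkl he⟩

theorem cross_bot : T.cross ⊥ = ∅ := by
  ext v
  simp only [mem_cross, Finset.notMem_empty, iff_false]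
  rintro ⟨i, j, hij, h, -⟩
  exact hij h

/-- Rigidity: comparable admissible partitions with the same crossing set are equal. An `s`-pair
meets where some `r`-pair meets, admissibility of `s` puts all four leaves in one class, and
matching them side by side leaves only pairs with a smaller join. -/
theorem Admissible.le_of_cross_subset (hT : T.IsTree) {r s : Setoid I} (hrs : r ≤ s)
    (hs : T.Admissible s) (h : T.cross s ⊆ T.cross r) : s ≤ r := by
  have key : ∀ n : ℕ, ∀ i j, (T.join i j).card = n → s i j → r i j := by
    intro n
    induction n using Nat.strong_induction_on with
    | _ n ih =>
      intro i j hn hij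
      by_cases hne : i = j
      · exact hne ▸ r.refl i
      obtain ⟨k, l, hkl, hr, he⟩ := mem_cross.1 (h (mem_cross.2 ⟨i, j, hne, hij, rfl⟩))
      have hik : s i k := hs i j k l hij (hrs hr) hne hkl he.symm
      have hjk : s j k := s.trans (s.symm hij) hik
      have hil : s i l := s.trans hik (hrs hr)
      have hjl : s j l := s.trans hjk (hrs hr)
      rcases join_ssubset_of_join_eq hT hne he.symm with ⟨h1, h2⟩ | ⟨h1, h2⟩
      · exact r.trans (ih _ (hn ▸ Finset.card_lt_card h1) i k rfl hik)
          (r.trans hr (r.symm (ih _ (hn ▸ Finset.card_lt_card h2) j l rfl hjl)))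
      · exact r.trans (ih _ (hn ▸ Finset.card_lt_card h1) i l rfl hil)
          (r.trans (r.symm hr) (r.symm (ih _ (hn ▸ Finset.card_lt_card h2) j k rfl hjk)))
  exact fun {i j} hij => key _ i j rfl hij

/-- The ultrametric property is applied along `a, i, j, b`. The needed inequalities of joins hold
because an equality would make `join i j` a crossing vertex, either directly or by forcing `i` and
`j` to be equivalent. -/
theorem Admissible.join_eq_or (hT : T.IsTree) {r : Setoid I} (hr : T.Admissible r) {i j a b : I}
    (hij : i ≠ j) (hv : T.join i j ∉ T.cross r) (ha : r a i) (hb : r j b) :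
    T.join a b = T.join i j ∨ (a ≠ i ∧ T.join a b = T.join a i) ∨
      (j ≠ b ∧ T.join a b = T.join j b) := by
  have h1 : T.join a j = T.join i j ∨ (a ≠ i ∧ T.join a j = T.join a i) := by
    by_cases hai : a = i
    · exact Or.inl (hai ▸ rfl)
    · have : T.join a i ≠ T.join i j := fun h => hv (mem_cross.2 ⟨a, i, hai, ha, h⟩)
      rcases join_eq_or_eq_of_ne hT this with h | h
      exacts [Or.inr ⟨hai, h⟩, Or.inl h]
  by_cases hjb : j = b
  · subst hjb
    rcases h1 with h | h
    exacts [Or.inl h, Or.inr (Or.inl h)]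
  have h2 : T.join a j ≠ T.join j b := by
    intro h
    rcases h1 with h' | ⟨hai, h'⟩
    · exact hv (mem_cross.2 ⟨j, b, hjb, hb, h ▸ h'⟩)
    · have : r i j := r.trans (r.symm ha) (hr a i j b ha hb hai hjb (h' ▸ h))
      exact hv (mem_cross.2 ⟨i, j, hij, this, rfl⟩)
  rcases join_eq_or_eq_of_ne hT h2 with h | h
  · rw [h]
    rcases h1 with h' | h'
    exacts [Or.inl h', Or.inr (Or.inl h')]
  · exact Or.inr (Or.inr ⟨hjb, h⟩)

/-- Uniting two classes creates no meeting point except `join i j`: any other one is already the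
meeting point of an `r`-pair inside the same new class. Admissibility and the crossing set of the
united partition both follow from this. -/
theorem Admissible.exists_of_uniteClasses (hT : T.IsTree) {r : Setoid I} (hr : T.Admissible r)
    {i j a b : I} (hij : i ≠ j) (hv : T.join i j ∉ T.cross r) (hab : a ≠ b)
    (h : uniteClasses r i j a b) :
    (T.join a b = T.join i j ∧ uniteClasses r i j a i) ∨
      ∃ c d, c ≠ d ∧ r c d ∧ T.join a b = T.join c d ∧ uniteClasses r i j a c := by
  have hai : ∀ a b, r a i → r j b → uniteClasses r i j a b →
      (T.join a b = T.join i j ∧ uniteClasses r i j a i) ∨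
      ∃ c d, c ≠ d ∧ r c d ∧ T.join a b = T.join c d ∧ uniteClasses r i j a c := by
    intro a b ha hb hab
    rcases hr.join_eq_or hT hij hv ha hb with h | ⟨h, h'⟩ | ⟨h, h'⟩
    · exact Or.inl ⟨h, Or.inl ha⟩
    · exact Or.inr ⟨a, i, h, ha, h', Or.inl (r.refl a)⟩
    · exact Or.inr ⟨j, b, h, hb, h', Or.inr (Or.inl ⟨ha, r.refl j⟩)⟩
  rcases h with h | ⟨ha, hb⟩ | ⟨ha, hb⟩
  · exact Or.inr ⟨a, b, hab, h, rfl, Or.inl (r.refl a)⟩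
  · exact hai a b ha hb (Or.inr (Or.inl ⟨ha, hb⟩))
  · have hba : uniteClasses r i j b a := Or.inr (Or.inl ⟨r.symm hb, r.symm ha⟩)
    have hab := (uniteClasses r i j).symm hba
    rw [join_comm a b]
    rcases hai b a (r.symm hb) (r.symm ha) hba with h | ⟨c, d, h1, h2, h3, h4⟩
    · exact Or.inl ⟨h.1, (uniteClasses r i j).trans hab h.2⟩
    · exact Or.inr ⟨c, d, h1, h2, h3, (uniteClasses r i j).trans hab h4⟩

theorem Admissible.uniteClasses (hT : T.IsTree) {r : Setoid I} (hr : T.Admissible r)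
    {i j : I} (hij : i ≠ j) (hv : T.join i j ∉ T.cross r) :
    T.Admissible (uniteClasses r i j) := by
  intro a b c d hab hcd hne hne' he
  set s := BinForest.uniteClasses r i j
  rcases hr.exists_of_uniteClasses hT hij hv hne hab with
    ⟨h1, h2⟩ | ⟨a', b', h1, h2, h3, h4⟩ <;>
  rcases hr.exists_of_uniteClasses hT hij hv hne' hcd with
    ⟨k1, k2⟩ | ⟨c', d', k1, k2, k3, k4⟩
  · exact s.trans h2 (s.symm k2)
  · exact absurd (mem_cross.2 ⟨c', d', k1, k2, by rw [← k3, ← he, h1]⟩) hv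
  · exact absurd (mem_cross.2 ⟨a', b', h1, h2, by rw [← h3, he, k1]⟩) hv
  · exact s.trans h4 (s.trans (Or.inl (hr a' b' c' d' h2 k2 h1 k1 (by rw [← h3, he, k3])))
      (s.symm k4))

theorem Admissible.cross_uniteClasses (hT : T.IsTree) {r : Setoid I} (hr : T.Admissible r)
    {i j : I} (hij : i ≠ j) (hv : T.join i j ∉ T.cross r) :
    T.cross (BinForest.uniteClasses r i j) = insert (T.join i j) (T.cross r) := by
  apply Finset.Subset.antisymm
  · intro v hv'
    obtain ⟨a, b, hab, h, rfl⟩ := mem_cross.1 hv'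
    rw [Finset.mem_insert]
    rcases hr.exists_of_uniteClasses hT hij hv hab h with h | ⟨c, d, h1, h2, h3, -⟩
    · exact Or.inl h.1
    · exact Or.inr (mem_cross.2 ⟨c, d, h1, h2, h3.symm⟩)
  · rw [Finset.insert_subset_iff]
    exact ⟨mem_cross.2 ⟨i, j, hij, uniteClasses_rel r i j, rfl⟩, cross_mono (le_uniteClasses r i j)⟩

/-- A pair of leaves for every vertex in `S` that meets there generates an admissible partition. -/
theorem exists_admissible_generated (hT : T.IsTree) (S : Finset (Finset I))
    (c : ∀ v ∈ S, I × I) (hc : ∀ v h, (c v h).1 ≠ (c v h).2)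
    (hj : ∀ v h, T.join (c v h).1 (c v h).2 = v) :
    ∃ r : Setoid I, T.Admissible r ∧ T.cross r = S ∧ (∀ v h, r (c v h).1 (c v h).2) ∧
      ∀ s : Setoid I, (∀ v h, s (c v h).1 (c v h).2) → r ≤ s := by
  induction S using Finset.induction_on with
  | empty => exact ⟨⊥, admissible_bot, cross_bot, by simp, fun _ _ => bot_le⟩
  | insert v S hv ih =>
    obtain ⟨r, hr, hS, hrc, hmin⟩ := ih (fun w h => c w (Finset.mem_insert_of_mem h))
      (fun w h => hc w _) (fun w h => hj w _)
    have hvS := Finset.mem_insert_self v S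
    -- The previous pairs cross only at vertices of `S`, so the new vertex is free and the classes
    -- of its pair may be united.
    have hnot : T.join (c v hvS).1 (c v hvS).2 ∉ T.cross r := by rwa [hj, hS]
    refine ⟨uniteClasses r (c v hvS).1 (c v hvS).2, hr.uniteClasses hT (hc v hvS) hnot, ?_, ?_, ?_⟩
    · rw [hr.cross_uniteClasses hT (hc v hvS) hnot, hj, hS]
    · intro w hw
      rcases Finset.mem_insert.1 hw with rfl | h
      · exact uniteClasses_rel _ _ _
      · exact le_uniteClasses _ _ _ (hrc w h)
    · exact fun s hs => uniteClasses_le (hmin s fun w h => hs w _) (hs v hvS)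

theorem mem_verts_of_mem_cross (hT : T.IsTree) {r : Setoid I} {v : Finset I} (h : v ∈ T.cross r) :
    v ∈ T.verts ∧ 1 < v.card := by
  obtain ⟨i, j, hij, -, rfl⟩ := mem_cross.1 h
  exact ⟨join_mem hT i j, one_lt_card_join hij⟩

theorem join_eq_of_mem_crossPairs (hT : T.IsTree) {r s : Setoid I} {v : Finset I} {p : I × I}
    (hv : v ∈ T.cross s) (h : p ∈ T.crossPairs r v) : T.join p.1 p.2 = v :=
  have hv' := mem_verts_of_mem_cross hT hv
  (join_eq_iff hT hv'.1 hv'.2).2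
    (Or.inl ⟨(mem_crossPairs.1 h).1, (mem_crossPairs.1 h).2.1⟩)

open Classical in
/-- The pairs chosen at the vertices of `S` generate a unique partition that crosses exactly at
`S`. -/
theorem sum_prod_card_crossPairs (hT : T.IsTree) (y : T.AdmSetoid) {S : Finset (Finset I)}
    (hS : S ⊆ T.cross y.1) :
    ∑ x : T.AdmSetoid with x ≤ y ∧ T.cross x.1 = S, ∏ v ∈ S, (T.crossPairs x.1 v).card =
      ∏ v ∈ S, (T.crossPairs y.1 v).card := by
  -- Each product counts choice functions that pick a crossing pair at every vertex of `S`. The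
  -- choices for `y` are the disjoint union, over the partitions `x`, of the choices for `x`: each
  -- choice belongs to the partition it generates.
  simp_rw [← Finset.card_pi]
  rw [← Finset.card_biUnion]
  · congr 1
    ext c
    simp only [Finset.mem_biUnion, Finset.mem_filter, Finset.mem_univ, true_and, Finset.mem_pi]
    constructor
    · rintro ⟨x, ⟨hxy, -⟩, h⟩ v hv
      have := mem_crossPairs.1 (h v hv)
      exact mem_crossPairs.2 ⟨this.1, this.2.1, hxy this.2.2⟩
    · intro h
      obtain ⟨r, hr, hrS, hrc, hmin⟩ := exists_admissible_generated hT S c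
        (fun v hv => ne_of_mem_crossPairs (h v hv))
        (fun v hv => join_eq_of_mem_crossPairs hT (hS hv) (h v hv))
      refine ⟨⟨r, hr⟩, ⟨hmin y.1 fun v hv => (mem_crossPairs.1 (h v hv)).2.2, hrS⟩, ?_⟩
      intro v hv
      have := mem_crossPairs.1 (h v hv)
      exact mem_crossPairs.2 ⟨this.1, this.2.1, hrc v hv⟩
  · intro x hx x' hx' hne
    simp only [Finset.coe_filter, Finset.mem_univ, true_and, Set.mem_ofPred_eq] at hx hx'
    rw [Function.onFun, Finset.disjoint_left]
    intro c hc hc'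
    rw [Finset.mem_pi] at hc hc'
    obtain ⟨r, hr, hrS, -, hmin⟩ := exists_admissible_generated hT S c
      (fun v hv => ne_of_mem_crossPairs (hc v hv))
      (fun v hv => join_eq_of_mem_crossPairs hT (hS hv) (hc v hv))
    -- Disjointness is rigidity: any partition crossing at `S` and containing the chosen pairs lies
    -- above the generated one and has the same crossing set.
    have aux : ∀ z : T.AdmSetoid, T.cross z.1 = S →
        (∀ v (h : v ∈ S), c v h ∈ T.crossPairs z.1 v) → z.1 = r := by
      intro z hz hzc
      have hle : r ≤ z.1 := hmin z.1 fun v hv => (mem_crossPairs.1 (hzc v hv)).2.2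
      exact le_antisymm (z.2.le_of_cross_subset hT hle (by rw [hz, hrS])) hle
    exact hne (Subtype.ext ((aux x hx.2 hc).trans (aux x' hx'.2 hc').symm))

/-- The value of the Möbius function between the least element and an admissible partition. -/
noncomputable def mobiusValue (T : BinForest I) (r : Setoid I) : ℤ :=
  ∏ v ∈ T.cross r, -((T.crossPairs r v).card : ℤ)

open Classical in
theorem sum_mobiusValue_mul_pow (hT : T.IsTree) {R : Type*} [CommRing R] (t : R)
    (y : T.AdmSetoid) :
    ∑ x : T.AdmSetoid with x ≤ y,
      (T.mobiusValue x.1 : R) * t ^ ((T.cross y.1).card - (T.cross x.1).card) =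
      ∏ v ∈ T.cross y.1, (t - ((T.crossPairs y.1 v).card : R)) := by
  -- The product expands over subsets `S` of the crossing set of `y`, and the sum is grouped by the
  -- crossing set of `x`; the terms for each `S` then agree by the count of choices.
  rw [Finset.prod_sub, ← Finset.sum_fiberwise_of_maps_to (g := fun x : T.AdmSetoid => T.cross x.1)
    (t := (T.cross y.1).powerset)]
  · refine Finset.sum_congr rfl fun S hS => ?_
    rw [Finset.mem_powerset] at hS
    rw [← Nat.cast_prod, ← sum_prod_card_crossPairs hT y hS, Nat.cast_sum, Finset.mul_sum,
      Finset.filter_filter]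
    refine Finset.sum_congr rfl fun x hx => ?_
    obtain rfl : T.cross x.1 = S := (Finset.mem_filter.1 hx).2.2
    rw [Finset.prod_const, Finset.card_sdiff_of_subset hS, mobiusValue, Finset.prod_neg]
    push_cast
    ring
  · intro x hx
    exact Finset.mem_powerset.2 (cross_mono (Finset.mem_filter.1 hx).2)

/-- Two crossing pairs at `v` lie in one class by admissibility. If they differed on a side, the two
equivalent leaves there would meet at a crossing vertex strictly below `v`. -/
theorem card_crossPairs_eq_one (hT : T.IsTree) {r : Setoid I} (hr : T.Admissible r)
    {v : Finset I} (hv : v ∈ T.cross r) (hmin : ∀ w ∈ T.cross r, ¬ w ⊂ v) :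
    (T.crossPairs r v).card = 1 := by
  obtain ⟨hvT, hc⟩ := mem_verts_of_mem_cross hT hv
  have hl := (T.left_spec hvT hc).2.2
  rw [Finset.card_eq_one]
  have hne : ∃ p, p ∈ T.crossPairs r v := by
    obtain ⟨i, j, hij, hr', h⟩ := mem_cross.1 hv
    rcases (join_eq_iff hT hvT hc).1 h with h | h
    · exact ⟨(i, j), mem_crossPairs.2 ⟨h.1, h.2, hr'⟩⟩
    · exact ⟨(j, i), mem_crossPairs.2 ⟨h.1, h.2, r.symm hr'⟩⟩
  obtain ⟨p, hp⟩ := hne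
  refine ⟨p, Finset.eq_singleton_iff_unique_mem.2 ⟨hp, fun q hq => ?_⟩⟩
  have hp' := mem_crossPairs.1 hp
  have hq' := mem_crossPairs.1 hq
  have h1 : r q.1 p.1 := hr q.1 q.2 p.1 p.2 hq'.2.2 hp'.2.2 (ne_of_mem_crossPairs hq)
    (ne_of_mem_crossPairs hp)
    ((join_eq_of_mem_crossPairs hT hv hq).trans (join_eq_of_mem_crossPairs hT hv hp).symm)
  have h2 : r q.2 p.2 := r.trans (r.symm hq'.2.2) (r.trans h1 hp'.2.2)
  have hp2 := Finset.mem_sdiff.1 hp'.2.1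
  have hq2 := Finset.mem_sdiff.1 hq'.2.1
  ext
  · by_contra hne
    exact hmin _ (mem_cross.2 ⟨q.1, p.1, hne, h1, rfl⟩)
      (join_ssubset_of_side hT hvT hc (hl hq'.1) (hl hp'.1) (by simp [hp'.1, hq'.1]))
  · by_contra hne
    exact hmin _ (mem_cross.2 ⟨q.2, p.2, hne, h2, rfl⟩)
      (join_ssubset_of_side hT hvT hc hq2.1 hp2.1 (by simp [hp2.2, hq2.2]))

open Classical in
-- At `t = 1`, a minimal crossing vertex contributes the factor `1 - 1`.
theorem sum_mobiusValue (hT : T.IsTree) (y : T.AdmSetoid) (hy : y.1 ≠ ⊥) :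
    ∑ x : T.AdmSetoid with x ≤ y, T.mobiusValue x.1 = 0 := by
  have h := sum_mobiusValue_mul_pow hT (1 : ℤ) y
  simp only [one_pow, mul_one, Int.cast_id] at h
  rw [h]
  have hne : (T.cross y.1).Nonempty := by
    rw [Finset.nonempty_iff_ne_empty]
    intro h
    exact hy (le_bot_iff.1 (y.2.le_of_cross_subset hT bot_le (by simp [h])))
  obtain ⟨v, hv⟩ := (T.cross y.1).exists_minimal hne
  refine Finset.prod_eq_zero hv.1 ?_
  rw [card_crossPairs_eq_one hT y.2 hv.1 fun w hw hlt => hlt.2 (hv.2 hw hlt.1)]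
  simp

theorem exists_admissible_succ (hT : T.IsTree) {x y : T.AdmSetoid} (h : x < y) :
    ∃ z : T.AdmSetoid, x ≤ z ∧ z ≤ y ∧ (T.cross z.1).card = (T.cross x.1).card + 1 := by
  have : ¬ T.cross y.1 ⊆ T.cross x.1 := fun h' => h.2 (y.2.le_of_cross_subset hT h.1 h')
  obtain ⟨v, hvy, hvx⟩ := Finset.not_subset.1 this
  obtain ⟨i, j, hij, hy, rfl⟩ := mem_cross.1 hvy
  refine ⟨⟨_, x.2.uniteClasses hT hij hvx⟩, le_uniteClasses x.1 i j, uniteClasses_le h.1 hy, ?_⟩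
  rw [x.2.cross_uniteClasses hT hij hvx, Finset.card_insert_of_notMem hvx]

theorem card_cross_lt (hT : T.IsTree) {x y : T.AdmSetoid} (h : x < y) :
    (T.cross x.1).card < (T.cross y.1).card :=
  Finset.card_lt_card ⟨cross_mono h.1, fun h' => h.2 (y.2.le_of_cross_subset hT h.1 h')⟩

end BinForest

/-! ### Forests below a tree as admissible partitions -/

namespace BinForest

variable {I : Type*}

open Classical in
/-- The elements of `v` that are equivalent to `i`. -/
noncomputable def block (r : Setoid I) (v : Finset I) (i : I) : Finset I :=
  v.filter fun j => r i j

theorem mem_block {r : Setoid I} {v : Finset I} {i j : I} :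
    j ∈ block r v i ↔ j ∈ v ∧ r i j := by simp [block]

theorem block_subset (r : Setoid I) (v : Finset I) (i : I) : block r v i ⊆ v :=
  fun _ h => (mem_block.1 h).1

theorem block_mono {r s : Setoid I} (hrs : r ≤ s) {v w : Finset I} (h : v ⊆ w) (i : I) :
    block r v i ⊆ block s w i := fun _ hj =>
  mem_block.2 ⟨h (mem_block.1 hj).1, hrs (mem_block.1 hj).2⟩

theorem self_mem_block {r : Setoid I} {v : Finset I} {i : I} (h : i ∈ v) : i ∈ block r v i :=
  mem_block.2 ⟨h, r.refl i⟩

theorem block_congr {r : Setoid I} (v : Finset I) {i j : I} (h : r i j) :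
    block r v i = block r v j := by
  ext k
  rw [mem_block, mem_block]
  exact and_congr_right fun _ => ⟨r.trans (r.symm h), r.trans h⟩

variable [DecidableEq I]

theorem isInner_iff {F : BinForest I} {v : F.Vertex} : F.IsInner v ↔ 1 < v.1.card := by
  constructor
  · intro h
    by_contra! hc
    have := Finset.card_pos.2 (F.nonempty_of_mem v.1 v.2)
    obtain ⟨i, hi⟩ := Finset.card_eq_one.1 (show v.1.card = 1 by omega)
    exact h i (Subtype.ext hi)
  · rintro h i rfl
    simp [leaf] at h

theorem covBy_of_disjoint {F : BinForest I} {B C w : F.Vertex} (hd : Disjoint B.1 C.1)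
    (hu : B.1 ∪ C.1 = w.1) : B ⋖ w := by
  have not_le : ∀ D E : F.Vertex, Disjoint D.1 E.1 → ¬ D.1 ⊆ E.1 := fun D E hd h => by
    obtain ⟨i, hi⟩ := F.nonempty_of_mem D.1 D.2
    exact Finset.disjoint_left.1 hd hi (h hi)
  have hBw : B.1 ⊆ w.1 := hu ▸ Finset.subset_union_left
  have hCw : C.1 ⊆ w.1 := hu ▸ Finset.subset_union_right
  refine ⟨⟨hBw, fun h => not_le C B hd.symm (hCw.trans h)⟩, fun z hBz hzw => ?_⟩
  rcases F.subset_child_of_ssubset z.2 B.2 C.2 hu hzw with h | h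
  · exact hBz.2 h
  · exact not_le B C hd (hBz.1.trans h)

theorem exists_children_covBy (F : BinForest I) (w : F.Vertex) (h : 1 < w.1.card) :
    ∃ B C : F.Vertex, B ⋖ w ∧ C ⋖ w ∧ Disjoint B.1 C.1 ∧ B.1 ∪ C.1 = w.1 := by
  obtain ⟨B, hB, C, hC, hd, hu⟩ := F.binary w.1 w.2 h
  exact ⟨⟨B, hB⟩, ⟨C, hC⟩, covBy_of_disjoint (C := ⟨C, hC⟩) hd hu,
    covBy_of_disjoint (C := ⟨B, hB⟩) hd.symm (by rw [Finset.union_comm]; exact hu), hd, hu⟩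

theorem ne_of_disjoint {F : BinForest I} {B C : F.Vertex} (h : Disjoint B.1 C.1) : B ≠ C := by
  rintro rfl
  obtain ⟨i, hi⟩ := F.nonempty_of_mem B.1 B.2
  exact Finset.disjoint_left.1 h hi hi

section ForestMap

variable {F G : BinForest I} {φ : F.Vertex → G.Vertex}

theorem IsForestMap.lt (hφ : IsForestMap F G φ) {u v : F.Vertex} (h : u < v) : φ u < φ v :=
  lt_of_le_of_ne (hφ.increasing _ _ h.le) fun h' => h.ne (Vertex.injective_of_isForestMap hφ h')

/-- If one image contained the other, the edge of `G` leaving the larger one would lie on the images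
of both edges into `x`. -/
theorem IsForestMap.disjoint_children (hφ : IsForestMap F G φ) {u u' x : F.Vertex} (h : u ⋖ x)
    (h' : u' ⋖ x) (hne : u ≠ u') : Disjoint (φ u).1 (φ u').1 := by
  have hs : F.SameTree u u' := ⟨x, h.le, h'.le⟩
  rcases G.laminar _ (φ u).2 _ (φ u').2 with k | k | k
  · exact absurd (hφ.tree_edge_injective u x u' x h h' hs (φ u') k (hφ.lt h'.lt) le_rfl
      (hφ.lt h'.lt)) hne
  · exact absurd (hφ.tree_edge_injective u x u' x h h' hs (φ u) le_rfl (hφ.lt h.lt) k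
      (hφ.lt h.lt)) hne
  · exact k

/-- The images of the two edges into `x` first meet at `φ x`: a vertex `v` containing leaves from
both sides contains both disjoint images, and if it were strictly below `φ x`, both paths would use
the edge leaving `v`. -/
theorem IsForestMap.subset_of_mem_children (hφ : IsForestMap F G φ) {u u' x : F.Vertex}
    (h : u ⋖ x) (h' : u' ⋖ x) (hne : u ≠ u') {v : Finset I} (hv : v ∈ G.verts) {i j : I}
    (hi : i ∈ u.1) (hj : j ∈ u'.1) (hiv : i ∈ v) (hjv : j ∈ v) : (φ x).1 ⊆ v := by
  have hd := hφ.disjoint_children h h' hne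
  have hi' := subset_of_isForestMap hφ u hi
  have hj' := subset_of_isForestMap hφ u' hj
  have h1 : (φ u).1 ⊆ v := by
    rcases G.subset_or_subset_of_mem (φ u).2 hv hi' hiv with k | k
    · exact k
    · exact absurd hj' (Finset.disjoint_left.1 hd (k hjv))
  have h2 : (φ u').1 ⊆ v := by
    rcases G.subset_or_subset_of_mem (φ u').2 hv hj' hjv with k | k
    · exact k
    · exact absurd (k hiv) (Finset.disjoint_left.1 hd hi')
  rcases G.subset_or_subset_of_mem (φ x).2 hv (hφ.increasing _ _ h.le hi') hiv with k | k
  · exact k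
  · by_contra hc
    have hlt : (⟨v, hv⟩ : G.Vertex) < φ x := ⟨k, hc⟩
    exact hne (hφ.tree_edge_injective u x u' x h h' ⟨x, h.le, h'.le⟩ ⟨v, hv⟩ h1 hlt h2 hlt)

end ForestMap

/-- Two leaves are equivalent if they are in the same tree of the forest. -/
def toSetoid (F : BinForest I) : Setoid I where
  r i j := ∃ w ∈ F.verts, i ∈ w ∧ j ∈ w
  iseqv :=
    { refl := fun i => ⟨{i}, F.leaf_mem i, by simp⟩
      symm := fun ⟨w, hw, hi, hj⟩ => ⟨w, hw, hj, hi⟩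
      trans := fun ⟨w, hw, hi, hj⟩ ⟨w', hw', hj', hk⟩ => by
        rcases F.subset_or_subset_of_mem hw hw' hj hj' with h | h
        · exact ⟨w', hw', h hi, hk⟩
        · exact ⟨w, hw, hi, h hk⟩ }

theorem exists_children_of_toSetoid {F : BinForest I} {i j : I} (h : F.toSetoid i j)
    (hij : i ≠ j) : ∃ w B C : F.Vertex, B ⋖ w ∧ C ⋖ w ∧ Disjoint B.1 C.1 ∧ B.1 ∪ C.1 = w.1 ∧
      i ∈ B.1 ∧ j ∈ C.1 := by
  obtain ⟨x, hx, hix, hjx⟩ := h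
  obtain ⟨w, hw, hs, hmin⟩ := F.exists_least_vertex (A := {i, j}) (by simp)
    ⟨x, hx, by simp [Finset.insert_subset_iff, hix, hjx]⟩
  have hi : i ∈ w := hs (by simp)
  have hj : j ∈ w := hs (by simp)
  obtain ⟨B, C, hB, hC, hd, hu⟩ := F.exists_children_covBy ⟨w, hw⟩
    (Finset.one_lt_card.2 ⟨i, hi, j, hj, hij⟩)
  have aux : ∀ D : F.Vertex, D ⋖ ⟨w, hw⟩ → ¬ (i ∈ D.1 ∧ j ∈ D.1) := fun D hD h =>
    hD.lt.2 (hmin D.1 D.2 (by simp [Finset.insert_subset_iff, h]))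
  have hi' : i ∈ B.1 ∪ C.1 := hu.symm ▸ hi
  have hj' : j ∈ B.1 ∪ C.1 := hu.symm ▸ hj
  have h1 := aux B hB
  have h2 := aux C hC
  rw [Finset.mem_union] at hi' hj'
  by_cases hiB : i ∈ B.1
  · exact ⟨⟨w, hw⟩, B, C, hB, hC, hd, hu, hiB, by tauto⟩
  · exact ⟨⟨w, hw⟩, C, B, hC, hB, hd.symm, by rw [Finset.union_comm]; exact hu,
      by tauto, by tauto⟩

theorem exists_vertex_of_toSetoid (F : BinForest I) [Fintype I] (i : I) :
    ∃ w ∈ F.verts, ∀ j, F.toSetoid i j → j ∈ w := by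
  obtain ⟨w, hw, hmax⟩ := (F.verts.filter (i ∈ ·)).exists_max_image Finset.card
    ⟨{i}, by simp [F.leaf_mem i]⟩
  rw [Finset.mem_filter] at hw
  refine ⟨w, hw.1, ?_⟩
  rintro j ⟨x, hx, hi, hj⟩
  rcases F.subset_or_subset_of_mem hx hw.1 hi hw.2 with h | h
  · exact h hj
  · exact Finset.eq_of_subset_of_card_le h (hmax x (by simp [hx, hi])) ▸ hj

theorem toSetoid_mono {F G : BinForest I} (h : F ≤ G) : F.toSetoid ≤ G.toSetoid := by
  obtain ⟨φ, hφ⟩ := h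
  rintro i j ⟨w, hw, hi, hj⟩
  exact ⟨_, (φ ⟨w, hw⟩).2, subset_of_isForestMap hφ ⟨w, hw⟩ hi,
    subset_of_isForestMap hφ ⟨w, hw⟩ hj⟩

section Tree

variable [Fintype I] {T : BinForest I}

/-- The map sends the vertex of `F` where two leaves meet to their join in `T`. By injectivity,
pairs with equal joins meet at the same vertex of `F`, hence in one tree. -/
theorem admissible_toSetoid (hT : T.IsTree) {F : BinForest I} (h : F ≤ T) :
    T.Admissible F.toSetoid := by
  obtain ⟨φ, hφ⟩ := h
  have key : ∀ i j, F.toSetoid i j → i ≠ j → ∃ w : F.Vertex, i ∈ w.1 ∧ j ∈ w.1 ∧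
      (φ w).1 = T.join i j := by
    intro i j h hij
    obtain ⟨w, B, C, hB, hC, hd, hu, hi, hj⟩ := exists_children_of_toSetoid h hij
    refine ⟨w, hB.le hi, hC.le hj, Finset.Subset.antisymm ?_ ?_⟩
    · exact hφ.subset_of_mem_children hB hC (ne_of_disjoint hd) (join_mem hT i j) hi hj
        (left_mem_join i j) (right_mem_join i j)
    · exact join_subset (φ w).2 (subset_of_isForestMap hφ w (hB.le hi))
        (subset_of_isForestMap hφ w (hC.le hj))
  intro i j k l hij hkl hne hne' he
  obtain ⟨w, hi, -, hw⟩ := key i j hij hne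
  obtain ⟨w', hk, -, hw'⟩ := key k l hkl hne'
  have : w = w' := Vertex.injective_of_isForestMap hφ (Subtype.ext (by rw [hw, hw', he]))
  subst this
  exact ⟨w.1, w.2, hi, hk⟩

/-- A normal form: a vertex of the induced forest is determined by its class and its least enclosing
vertex of `T`. -/
theorem eq_block_lca {r : Setoid I} {v : Finset I} (hv : v ∈ T.verts) {i j : I}
    (hj : j ∈ block r v i) : block r v i = block r (T.lca (block r v i)) j := by
  have hij := (mem_block.1 hj).2
  apply Finset.Subset.antisymm
  · intro k hk
    exact mem_block.2 ⟨subset_lca _ hk, r.trans (r.symm hij) (mem_block.1 hk).2⟩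
  · rw [← block_congr _ hij]
    exact block_mono le_rfl (lca_subset hv (block_subset r v i)) i

open Classical in
/-- The forest that is induced by a tree on the classes of an equivalence relation. -/
noncomputable def ofSetoid (T : BinForest I) (hT : T.IsTree) (r : Setoid I) : BinForest I where
  verts := Finset.univ.filter fun A => ∃ v ∈ T.verts, ∃ i ∈ v, A = block r v i
  nonempty_of_mem := by
    simp only [Finset.mem_filter, Finset.mem_univ, true_and]
    rintro A ⟨v, -, i, hi, rfl⟩
    exact ⟨i, self_mem_block hi⟩
  leaf_mem i := by
    simp only [Finset.mem_filter, Finset.mem_univ, true_and]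
    refine ⟨{i}, T.leaf_mem i, i, by simp, ?_⟩
    ext j
    simp only [mem_block, Finset.mem_singleton]
    exact ⟨fun h => ⟨h, h ▸ r.refl i⟩, fun h => h.1⟩
  laminar := by
    simp only [Finset.mem_filter, Finset.mem_univ, true_and]
    rintro A ⟨v, hv, i, hi, rfl⟩ B ⟨w, hw, j, hj, rfl⟩
    by_cases hij : r i j
    · rw [block_congr v hij]
      rcases T.laminar v hv w hw with h | h | h
      · exact Or.inl (block_mono le_rfl h j)
      · exact Or.inr (Or.inl (block_mono le_rfl h j))
      · exact Or.inr (Or.inr (Finset.disjoint_of_subset_left (block_subset r v j)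
          (Finset.disjoint_of_subset_right (block_subset r w j) h)))
    · refine Or.inr (Or.inr (Finset.disjoint_left.2 fun k hk hk' => hij ?_))
      exact r.trans (mem_block.1 hk).2 (r.symm (mem_block.1 hk').2)
  binary := by
    simp only [Finset.mem_filter, Finset.mem_univ, true_and]
    rintro A ⟨v, hv, i, hi, rfl⟩ hc
    -- The block may lie on one side of `v`, so it is split at its least enclosing vertex instead,
    -- where both parts are nonempty.
    obtain ⟨a, ha, b, hb, hab, hj⟩ := exists_join_eq_lca hT hc
    have hA := eq_block_lca hv (self_mem_block (r := r) hi)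
    rw [← hj] at hA
    have hvT := join_mem hT a b
    obtain ⟨hl, hr, hs⟩ := T.left_spec hvT (one_lt_card_join hab)
    have ha' := (mem_block.1 ha).2
    have hb' := (mem_block.1 hb).2
    have hu : block r (T.left (T.join a b)) i ∪ block r (T.join a b \ T.left (T.join a b)) i =
        block r v i := by
      rw [hA]
      ext k
      simp only [Finset.mem_union, mem_block, Finset.mem_sdiff]
      have := @hs k
      tauto
    have hd : Disjoint (block r (T.left (T.join a b)) i)
        (block r (T.join a b \ T.left (T.join a b)) i) :=
      Finset.disjoint_of_subset_left (block_subset _ _ _)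
        (Finset.disjoint_of_subset_right (block_subset _ _ _) Finset.disjoint_sdiff)
    rcases (join_eq_iff hT hvT (one_lt_card_join hab)).1 rfl with h | h
    · exact ⟨_, ⟨_, hl, a, h.1, block_congr _ ha'⟩, _, ⟨_, hr, b, h.2, block_congr _ hb'⟩, hd, hu⟩
    · exact ⟨_, ⟨_, hl, b, h.1, block_congr _ hb'⟩, _, ⟨_, hr, a, h.2, block_congr _ ha'⟩, hd, hu⟩

theorem mem_ofSetoid {hT : T.IsTree} {r : Setoid I} {A : Finset I} :
    A ∈ (T.ofSetoid hT r).verts ↔ ∃ v ∈ T.verts, ∃ i ∈ v, A = block r v i := by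
  simp [ofSetoid]

theorem eq_block_of_mem_ofSetoid {hT : T.IsTree} {r : Setoid I} {A : Finset I}
    (hA : A ∈ (T.ofSetoid hT r).verts) {i : I} (hi : i ∈ A) : A = block r (T.lca A) i := by
  obtain ⟨v, hv, j, hj, rfl⟩ := mem_ofSetoid.1 hA
  exact eq_block_lca hv hi

theorem rel_of_mem_ofSetoid {hT : T.IsTree} {r : Setoid I} {A : Finset I}
    (hA : A ∈ (T.ofSetoid hT r).verts) {i j : I} (hi : i ∈ A) (hj : j ∈ A) : r i j := by
  rw [eq_block_of_mem_ofSetoid hA hi] at hj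
  exact (mem_block.1 hj).2

theorem toSetoid_ofSetoid (hT : T.IsTree) (r : Setoid I) : (T.ofSetoid hT r).toSetoid = r := by
  ext i j
  constructor
  · rintro ⟨w, hw, hi, hj⟩
    exact rel_of_mem_ofSetoid hw hi hj
  · intro h
    exact ⟨block r Finset.univ i, mem_ofSetoid.2 ⟨_, hT, i, Finset.mem_univ i, rfl⟩,
      self_mem_block (Finset.mem_univ i), mem_block.2 ⟨Finset.mem_univ j, h⟩⟩

theorem ofSetoid_top (hT : T.IsTree) : T.ofSetoid hT ⊤ = T := by
  have hb : ∀ v i, block (⊤ : Setoid I) v i = v := fun v i => by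
    ext j
    rw [mem_block]
    exact and_iff_left trivial
  ext A
  rw [mem_ofSetoid]
  simp only [hb]
  constructor
  · rintro ⟨v, hv, i, hi, rfl⟩
    exact hv
  · intro hA
    obtain ⟨i, hi⟩ := T.nonempty_of_mem A hA
    exact ⟨A, hA, i, hi, rfl⟩

theorem ofSetoid_toSetoid (hT : T.IsTree) {F : BinForest I} (h : F ≤ T) :
    T.ofSetoid hT F.toSetoid = F := by
  obtain ⟨φ, hφ⟩ := h
  ext A
  rw [mem_ofSetoid]
  constructor
  · rintro ⟨v, hv, i, hi, rfl⟩
    set A := block F.toSetoid v i with hA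
    have hiA : i ∈ A := self_mem_block hi
    by_cases hc : 1 < A.card
    · obtain ⟨w, hw, hiw⟩ := F.exists_vertex_of_toSetoid i
      obtain ⟨x, hx, hAx, hmin⟩ := F.exists_least_vertex ⟨i, hiA⟩
        ⟨w, hw, fun j hj => hiw j (mem_block.1 hj).2⟩
      obtain ⟨B, C, hB, hC, hd, hu⟩ := F.exists_children_covBy ⟨x, hx⟩
        (hc.trans_le (Finset.card_le_card hAx))
      have hAu : A ⊆ B.1 ∪ C.1 := hu.symm ▸ hAx
      have hBA : ∃ b ∈ A, b ∉ C.1 := by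
        by_contra! hcon
        exact hC.lt.2 (hmin C.1 C.2 hcon)
      have hCA : ∃ c ∈ A, c ∉ B.1 := by
        by_contra! hcon
        exact hB.lt.2 (hmin B.1 B.2 hcon)
      obtain ⟨b, hbA, hbC⟩ := hBA
      obtain ⟨c, hcA, hcB⟩ := hCA
      have hb : b ∈ B.1 := (Finset.mem_union.1 (hAu hbA)).resolve_right hbC
      have hc : c ∈ C.1 := (Finset.mem_union.1 (hAu hcA)).resolve_left hcB
      -- The block meets both children of the least vertex `x` of `F` above it, so the image of `x`
      -- lies in `v`; this forces the block to be all of `x`.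
      have hxv : x ⊆ v := (subset_of_isForestMap hφ ⟨x, hx⟩).trans
        (hφ.subset_of_mem_children hB hC (ne_of_disjoint hd) hv hb hc
          (block_subset _ _ _ hbA) (block_subset _ _ _ hcA))
      have : A = x := Finset.Subset.antisymm hAx fun j hj =>
        mem_block.2 ⟨hxv hj, x, hx, hAx hiA, hj⟩
      exact this ▸ hx
    · have := Finset.card_pos.2 ⟨i, hiA⟩
      obtain ⟨j, hj⟩ := Finset.card_eq_one.1 (show A.card = 1 by omega)
      exact hj ▸ F.leaf_mem j
  · intro hA
    obtain ⟨i, hi⟩ := F.nonempty_of_mem A hA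
    have hsub := subset_of_isForestMap hφ ⟨A, hA⟩
    refine ⟨_, (φ ⟨A, hA⟩).2, i, hsub hi, Finset.Subset.antisymm
      (fun j hj => mem_block.2 ⟨hsub hj, A, hA, hi, hj⟩) fun j hj => ?_⟩
    obtain ⟨hj, hij⟩ := mem_block.1 hj
    by_contra hjA
    obtain ⟨x, B, C, hB, hC, hd, hu, hiB, hjC⟩ :=
      exists_children_of_toSetoid hij fun h => hjA (h ▸ hi)
    -- A leaf `j` of the same tree outside `A` branches off from `i` above `A`. Then the image of
    -- `A` lies in that of `B`, which is disjoint from the image of `C` containing `j`.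
    have hAB : A ⊆ B.1 := by
      have hAx : A ⊂ x.1 := by
        rcases F.subset_or_subset_of_mem hA x.2 hi (hB.le hiB) with k | k
        · exact ⟨k, fun k' => hjA (k' (hC.le hjC))⟩
        · exact absurd (k (hC.le hjC)) hjA
      rcases F.subset_child_of_ssubset hA B.2 C.2 hu hAx with k | k
      · exact k
      · exact absurd (k hi) (Finset.disjoint_left.1 hd hiB)
    exact Finset.disjoint_left.1 (hφ.disjoint_children hB hC (ne_of_disjoint hd))
      (hφ.increasing ⟨A, hA⟩ B hAB hj) (subset_of_isForestMap hφ C hjC)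

/-- A vertex `A` is sent to the part of its `s`-class inside `lca A`. This keeps `lca A`, so
injectivity on a tree is the normal form, and injectivity on all inner vertices is admissibility of
`r`. -/
theorem ofSetoid_mono (hT : T.IsTree) {r s : Setoid I} (hr : T.Admissible r) (hrs : r ≤ s) :
    T.ofSetoid hT r ≤ T.ofSetoid hT s := by
  classical
  set F := T.ofSetoid hT r with hF
  set G := T.ofSetoid hT s with hG
  -- the vertex that contains `A` and is last on the path to the root below `lca A`
  let hull : Finset I → Finset I := fun A => (T.lca A).filter fun j => ∃ i ∈ A, s i j
  have hull_eq : ∀ A ∈ F.verts, ∀ i ∈ A, hull A = block s (T.lca A) i := by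
    intro A hA i hi
    ext j
    simp only [hull, Finset.mem_filter, mem_block]
    refine and_congr_right fun _ => ⟨?_, fun h => ⟨i, hi, h⟩⟩
    rintro ⟨k, hk, hkj⟩
    exact s.trans (hrs (rel_of_mem_ofSetoid hA hi hk)) hkj
  have subset_hull : ∀ A, A ⊆ hull A := fun A i hi =>
    Finset.mem_filter.2 ⟨subset_lca A hi, i, hi, s.refl i⟩
  have hull_mono : ∀ A B, A ⊆ B → hull A ⊆ hull B := fun A B h j hj => by
    obtain ⟨hj, i, hi, hij⟩ := Finset.mem_filter.1 hj
    exact Finset.mem_filter.2 ⟨lca_mono h hj, i, h hi, hij⟩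
  have lca_hull : ∀ A ∈ F.verts, T.lca (hull A) = T.lca A := fun A hA =>
    Finset.Subset.antisymm (lca_subset (lca_mem hT (F.nonempty_of_mem A hA))
      (Finset.filter_subset _ _)) (lca_mono (subset_hull A))
  have hull_subset : ∀ A, ∀ w ∈ G.verts, A ⊆ w → hull A ⊆ w := by
    intro A w hw h j hj
    obtain ⟨hj, i, hi, hij⟩ := Finset.mem_filter.1 hj
    rw [eq_block_of_mem_ofSetoid hw (h hi)]
    exact mem_block.2 ⟨lca_mono h hj, hij⟩
  have hull_mem : ∀ A ∈ F.verts, hull A ∈ G.verts := by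
    intro A hA
    obtain ⟨i, hi⟩ := F.nonempty_of_mem A hA
    exact mem_ofSetoid.2 ⟨_, lca_mem hT ⟨i, hi⟩, i, subset_lca A hi, hull_eq A hA i hi⟩
  have eq_of_lca : ∀ A ∈ F.verts, ∀ B ∈ F.verts, ∀ i ∈ A, ∀ j ∈ B, r i j →
      T.lca A = T.lca B → A = B := by
    intro A hA B hB i hi j hj hij h
    rw [eq_block_of_mem_ofSetoid hA hi, eq_block_of_mem_ofSetoid hB hj, ← h, block_congr _ hij]
  have rel_of_sameTree : ∀ u v : F.Vertex, F.SameTree u v → ∀ i ∈ u.1, ∀ j ∈ v.1, r i j := by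
    rintro u v ⟨w, hu, hv⟩ i hi j hj
    exact rel_of_mem_ofSetoid w.2 (hu hi) (hv hj)
  refine ⟨fun u => ⟨hull u.1, hull_mem u.1 u.2⟩, ?_, ?_, ?_, ?_, ?_, ?_⟩
  · exact fun u v h => hull_mono _ _ h
  · intro v hv
    rw [isInner_iff] at hv ⊢
    exact hv.trans_le (Finset.card_le_card (subset_hull v.1))
  · intro u v hu hv h
    have hl : T.lca u.1 = T.lca v.1 := by
      rw [← lca_hull _ u.2, ← lca_hull _ v.2]
      exact congrArg T.lca (Subtype.ext_iff.1 h)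
    obtain ⟨i, hi, j, hj, hij, he⟩ := exists_join_eq_lca hT (isInner_iff.1 hu)
    obtain ⟨k, hk, l, hl', hkl, he'⟩ := exists_join_eq_lca hT (isInner_iff.1 hv)
    exact Subtype.ext (eq_of_lca _ u.2 _ v.2 i hi k hk (hr i j k l
      (rel_of_mem_ofSetoid u.2 hi hj) (rel_of_mem_ofSetoid v.2 hk hl') hij hkl
      (by rw [he, he', hl])) hl)
  · intro i
    refine Subtype.ext (Finset.Subset.antisymm ?_ (subset_hull {i}))
    exact (Finset.filter_subset _ _).trans (lca_singleton i).le
  · intro u v hs h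
    have hl : T.lca u.1 = T.lca v.1 := by
      rw [← lca_hull _ u.2, ← lca_hull _ v.2]
      exact congrArg T.lca (Subtype.ext_iff.1 h)
    obtain ⟨i, hi⟩ := F.nonempty_of_mem _ u.2
    obtain ⟨j, hj⟩ := F.nonempty_of_mem _ v.2
    exact Subtype.ext (eq_of_lca _ u.2 _ v.2 i hi j hj (rel_of_sameTree u v hs i hi j hj) hl)
  · intro u v u' v' h h' hs w h1 h2 h3 h4
    obtain ⟨i, hi⟩ := F.nonempty_of_mem _ u.2
    obtain ⟨j, hj⟩ := F.nonempty_of_mem _ u'.2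
    have hij := rel_of_sameTree u u' hs i hi j hj
    -- The lower end of an edge of `F` whose image passes through `w` is recovered from `w` and the
    -- `r`-class: the block cut out by `lca w` lies between `u` and `v`, and it is not `v` because
    -- the hull of `v` is not contained in `w`.
    have key : ∀ u v : F.Vertex, u ⋖ v → hull u.1 ⊆ w.1 → w.1 ⊂ hull v.1 → ∀ i ∈ u.1,
        u.1 = block r (T.lca w.1) i := by
      intro u v h h1 h2 i hi
      have huw : u.1 ⊆ w.1 := (subset_hull u.1).trans h1
      have hx : block r (T.lca w.1) i ∈ F.verts := mem_ofSetoid.2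
        ⟨_, lca_mem hT (G.nonempty_of_mem _ w.2), i, subset_lca _ (huw hi), rfl⟩
      have hux : u.1 ⊆ block r (T.lca w.1) i := by
        conv_lhs => rw [eq_block_of_mem_ofSetoid u.2 hi]
        exact block_mono le_rfl (lca_mono huw) i
      have hxw : block r (T.lca w.1) i ⊆ w.1 := by
        conv_rhs => rw [eq_block_of_mem_ofSetoid w.2 (huw hi)]
        exact block_mono hrs subset_rfl i
      have hxv : block r (T.lca w.1) i ⊆ v.1 := by
        rw [eq_block_of_mem_ofSetoid v.2 (h.le hi), ← lca_hull v.1 v.2]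
        exact block_mono le_rfl (lca_mono h2.1) i
      by_contra hne
      refine h.2 (c := ⟨_, hx⟩) (lt_of_le_of_ne hux fun h => hne (Subtype.ext_iff.1 h)) ?_
      refine lt_of_le_of_ne hxv fun he => h2.2 (hull_subset _ _ w.2 ?_)
      exact (Subtype.ext_iff.1 he : _ = v.1) ▸ hxw
    refine Subtype.ext ?_
    rw [key u v h h1 h2 i hi, key u' v' h' h3 h4 j hj, block_congr _ hij]

/-- The forests below a tree are induced on the blocks of the admissible partitions. -/
noncomputable def iccOrderIso (hT : T.IsTree) : Set.Icc ⊥ T ≃o T.AdmSetoid where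
  toFun F := ⟨F.1.toSetoid, admissible_toSetoid hT F.2.2⟩
  invFun r := ⟨T.ofSetoid hT r.1, bot_le,
    (ofSetoid_mono hT r.2 le_top).trans_eq (ofSetoid_top hT)⟩
  left_inv F := Subtype.ext (ofSetoid_toSetoid hT F.2.2)
  right_inv r := Subtype.ext (toSetoid_ofSetoid hT r.1)
  map_rel_iff' {F G} := by
    refine ⟨fun h => ?_, fun h => toSetoid_mono h⟩
    have := ofSetoid_mono hT (s := G.1.toSetoid) (admissible_toSetoid hT F.2.2) h
    rwa [ofSetoid_toSetoid hT F.2.2, ofSetoid_toSetoid hT G.2.2] at this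

end Tree

end BinForest

/-! ### Rank functions, Möbius recursion and lattices in finite posets -/

section GradedPoset

variable {P : Type*} [PartialOrder P] {ρ : P → ℕ}

theorem CovBy.rank_eq_add_one
    (hs : ∀ x y, x < y → ∃ z, x ≤ z ∧ z ≤ y ∧ ρ z = ρ x + 1) {x y : P} (h : x ⋖ y) :
    ρ y = ρ x + 1 := by
  obtain ⟨z, hxz, hzy, hz⟩ := hs x y h.lt
  have hlt : x < z := lt_of_le_of_ne hxz (by rintro rfl; omega)
  rcases hzy.eq_or_lt with rfl | h'
  · exact hz
  · exact absurd h' (h.2 hlt)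

/-- Strict monotonicity bounds the height above by `ρ`; climbing from `⊥` in steps that raise `ρ` by
one gives a chain of length `ρ x`. -/
theorem posetRank_eq [OrderBot P] (hρ : StrictMono ρ) (h0 : ρ ⊥ = 0)
    (hs : ∀ x y, x < y → ∃ z, x ≤ z ∧ z ≤ y ∧ ρ z = ρ x + 1) (x : P) : posetRank x = ρ x := by
  have key : ∀ n : ℕ, ∀ x y : P, x ≤ y → ρ y = ρ x + n →
      Order.height x + n ≤ Order.height y := by
    intro n
    induction n with
    | zero => exact fun x y h _ => by simpa using Order.height_mono h
    | succ n ih =>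
      intro x y h hn
      obtain ⟨z, hxz, hzy, hz⟩ := hs x y (lt_of_le_of_ne h (by rintro rfl; omega))
      have h1 := ih z y hzy (by omega)
      have h2 := Order.height_add_one_le (lt_of_le_of_ne hxz (by rintro rfl; omega))
      calc Order.height x + (n + 1 : ℕ) = Order.height x + 1 + n := by push_cast; ring
        _ ≤ Order.height z + n := by gcongr
        _ ≤ Order.height y := h1
  have h1 : Order.height x ≤ ρ x :=
    (Order.height_le_height_apply_of_strictMono ρ hρ x).trans_eq (by simp)
  have h2 := key (ρ x) ⊥ x bot_le (by omega)
  rw [Order.height_bot, zero_add] at h2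
  rw [posetRank, le_antisymm h1 h2, ENat.toNat_natCast]

theorem isGradedPoset_of_rank [OrderBot P] (hρ : StrictMono ρ) (h0 : ρ ⊥ = 0)
    (hs : ∀ x y, x < y → ∃ z, x ≤ z ∧ z ≤ y ∧ ρ z = ρ x + 1) : IsGradedPoset P := by
  intro x c hc hx
  have key : ∀ i : Fin (c.length + 1), ρ (c i) = i := by
    intro i
    induction i using Fin.induction with
    | zero => rw [show c 0 = ⊥ from hc, h0]; rfl
    | succ i ih =>
      have h : c i.castSucc ⋖ c i.succ := c.step i
      rw [h.rank_eq_add_one hs, ih]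
      rfl
  rw [posetRank_eq hρ h0 hs, ← hx]
  exact (key (Fin.last _)).symm

theorem mu_bot_eq_of_sum_eq_zero [OrderBot P] [LocallyFiniteOrder P] [DecidableEq P]
    {f : P → ℤ} (h0 : f ⊥ = 1) (h : ∀ y ≠ ⊥, ∑ x ∈ Finset.Icc ⊥ y, f x = 0) (y : P) :
    IncidenceAlgebra.mu ℤ ⊥ y = f y := by
  suffices ∀ n : ℕ, ∀ y : P, (Finset.Icc ⊥ y).card = n → IncidenceAlgebra.mu ℤ ⊥ y = f y from
    this _ y rfl
  intro n
  induction n using Nat.strong_induction_on with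
  | _ n ih =>
    intro y hn
    by_cases hy : y = ⊥
    · rw [hy, IncidenceAlgebra.mu_self, h0]
    · have hsum := h y hy
      rw [← Finset.Ico_insert_right bot_le, Finset.sum_insert (by simp)] at hsum
      rw [IncidenceAlgebra.mu_eq_neg_sum_Ico_of_ne (Ne.symm hy), eq_neg_of_add_eq_zero_left hsum,
        neg_inj]
      refine Finset.sum_congr rfl fun x hx => ih _ ?_ x rfl
      rw [← hn]
      have hxy := (Finset.mem_Ico.1 hx).2
      refine Finset.card_lt_card ⟨Finset.Icc_subset_Icc_right hxy.le, fun hsub => ?_⟩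
      exact hxy.not_ge (Finset.mem_Icc.1 (hsub (Finset.mem_Icc.2 ⟨bot_le, le_rfl⟩))).2

open Classical Polynomial in
theorem charPolynomial_eq [BoundedOrder P] [Fintype P] (hρ : StrictMono ρ) (hρ0 : ρ ⊥ = 0)
    (hs : ∀ x y, x < y → ∃ z, x ≤ z ∧ z ≤ y ∧ ρ z = ρ x + 1) {f : P → ℤ} (h0 : f ⊥ = 1)
    (h : ∀ y ≠ ⊥, ∑ x with x ≤ y, f x = 0) :
    charPolynomial P = ∑ y : P, C (f y) * X ^ (ρ ⊤ - ρ y) := by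
  unfold charPolynomial
  -- The two sums may use different `Fintype` instances on `P`, so the index sets are matched by
  -- extensionality.
  refine Finset.sum_congr (by ext; simp) fun y _ => ?_
  let : Fintype P := Fintype.ofFinite P
  let : LocallyFiniteOrder P := Fintype.toLocallyFiniteOrder
  rw [posetRank_eq hρ hρ0 hs, posetRank_eq hρ hρ0 hs]
  congr 2
  refine mu_bot_eq_of_sum_eq_zero h0 ?_ y
  intro y hy
  rw [← h y hy]
  exact Finset.sum_congr (by ext; simp) fun _ _ => rfl

/-- The join of two elements is the meet of their finitely many upper bounds; the top serves as the
empty meet. -/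
theorem isLatticeOrder_of_exists_isGLB [Finite P] [OrderTop P]
    (h : ∀ x y : P, ∃ z, IsGLB {x, y} z) : IsLatticeOrder P := by
  have hfin : ∀ s : Finset P, ∃ z, IsGLB (s : Set P) z := by
    classical
    intro s
    induction s using Finset.induction_on with
    | empty => exact ⟨⊤, by simp⟩
    | insert a s _ ih =>
      obtain ⟨z, hz⟩ := ih
      obtain ⟨w, hw⟩ := h a z
      refine ⟨w, ?_⟩
      rw [Finset.coe_insert]
      rw [isGLB_iff_le_iff] at hw hz ⊢
      intro b
      rw [hw b, mem_lowerBounds_iff_subset_Ici, mem_lowerBounds_iff_subset_Ici]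
      have := hz b
      rw [mem_lowerBounds_iff_subset_Ici] at this
      simp only [Set.insert_subset_iff, Set.singleton_subset_iff, Set.mem_Ici, this]
  intro x y
  refine ⟨?_, h x y⟩
  obtain ⟨z, hz⟩ := hfin (Set.toFinite (upperBounds {x, y})).toFinset
  rw [Set.Finite.coe_toFinset] at hz
  exact ⟨z, isGLB_upperBounds.1 hz⟩

end GradedPoset

/-! ### The top partition and the characteristic polynomial -/

namespace BinForest

variable {I : Type*} [DecidableEq I] {T : BinForest I}

theorem crossPairs_top (v : Finset I) : T.crossPairs ⊤ v = T.left v ×ˢ (v \ T.left v) := by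
  ext p
  rw [mem_crossPairs, Finset.mem_product, ← and_assoc]
  exact and_iff_left trivial

theorem mem_innerVerts {v : T.Vertex} : v ∈ T.innerVerts ↔ T.IsInner v := by simp [innerVerts]

variable [Fintype I]

theorem exists_isGLB_admSetoid (x y : T.AdmSetoid) : ∃ z, IsGLB {x, y} z := by
  refine ⟨⟨x.1 ⊓ y.1, x.2.inf y.2⟩, ?_⟩
  rw [isGLB_iff_le_iff]
  intro b
  simp only [lowerBounds_insert, lowerBounds_singleton, Set.mem_inter_iff, Set.mem_Iic]
  exact le_inf_iff (a := x.1) (b := y.1) (c := b.1)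

theorem mobiusValue_bot : T.mobiusValue ⊥ = 1 := by rw [mobiusValue, cross_bot, Finset.prod_empty]

/-- For the one-block partition every pair with a leaf on each side crosses, so the count is the
product of the sizes of the two children. -/
theorem e_eq_card_crossPairs {v : T.Vertex} (hv : T.IsInner v) :
    T.e v = (T.crossPairs ⊤ v.1).card := by
  classical
  obtain ⟨hl, hr, hs⟩ := T.left_spec v.2 (isInner_iff.1 hv)
  have hd : Disjoint (T.left v.1) (v.1 \ T.left v.1) := Finset.disjoint_sdiff
  have hl' : (⟨_, hl⟩ : T.Vertex) ⋖ v :=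
    covBy_of_disjoint (C := ⟨_, hr⟩) hd (Finset.union_sdiff_of_subset hs)
  have hr' : (⟨_, hr⟩ : T.Vertex) ⋖ v :=
    covBy_of_disjoint (C := ⟨_, hl⟩) hd.symm (Finset.sdiff_union_of_subset hs)
  have hch : T.children v = {⟨_, hl⟩, ⟨_, hr⟩} := by
    ext u
    simp only [children, Finset.mem_filter, Finset.mem_univ, true_and, Finset.mem_insert,
      Finset.mem_singleton]
    constructor
    · intro h
      rcases T.subset_left_or_subset_sdiff v.2 u.2 h.lt with k | k
      · left
        by_contra hne
        exact h.2 (c := ⟨_, hl⟩) (lt_of_le_of_ne k hne) hl'.lt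
      · right
        by_contra hne
        exact h.2 (c := ⟨_, hr⟩) (lt_of_le_of_ne k hne) hr'.lt
    · rintro (rfl | rfl)
      exacts [hl', hr']
  have hanc : ∀ u : T.Vertex, T.ancestorLeaves u = u.1 := by
    intro u
    ext i
    simp only [ancestorLeaves, Finset.mem_filter, Finset.mem_univ, true_and]
    exact Finset.singleton_subset_iff
  rw [e, hch, Finset.prod_pair (ne_of_disjoint hd), hanc, hanc, crossPairs_top,
    Finset.card_product]

theorem mem_cross_top (hT : T.IsTree) {v : Finset I} :
    v ∈ T.cross ⊤ ↔ v ∈ T.verts ∧ 1 < v.card := by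
  refine ⟨mem_verts_of_mem_cross hT, fun ⟨hv, hc⟩ => ?_⟩
  obtain ⟨i, -, j, -, hij, h⟩ := exists_join_eq_lca hT hc
  exact mem_cross.2 ⟨i, j, hij, trivial,
    h.trans (Finset.Subset.antisymm (lca_subset hv subset_rfl) (subset_lca v))⟩

theorem prod_cross_top (hT : T.IsTree) {R : Type*} [CommRing R] (t : R) :
    ∏ v ∈ T.cross ⊤, (t - ((T.crossPairs ⊤ v).card : R)) =
      ∏ v ∈ T.innerVerts, (t - (T.e v : R)) := by
  symm
  refine Finset.prod_bij (fun v _ => v.1) ?_ (fun _ _ _ _ h => Subtype.ext h) ?_ ?_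
  · intro v hv
    exact (mem_cross_top hT).2 ⟨v.2, isInner_iff.1 (mem_innerVerts.1 hv)⟩
  · intro v hv
    obtain ⟨hv, hc⟩ := (mem_cross_top hT).1 hv
    exact ⟨⟨v, hv⟩, mem_innerVerts.2 (isInner_iff.2 hc), rfl⟩
  · intro v hv
    rw [e_eq_card_crossPairs (mem_innerVerts.1 hv)]

end BinForest

open Polynomial in
theorem mainTheorem5 {I : Type*} [Fintype I] [DecidableEq I] (T : BinForest I) (hT : T.IsTree) :
    IsLatticeOrder (Set.Icc ⊥ T) ∧ IsGradedPoset (Set.Icc ⊥ T) ∧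
      charPolynomial (Set.Icc ⊥ T) = ∏ v ∈ T.innerVerts, (X - C (T.e v : ℤ)) := by
  classical
  let φ := BinForest.iccOrderIso hT
  let top : T.AdmSetoid := ⟨⊤, BinForest.admissible_top⟩
  have hbot : (φ ⊥).1 = ⊥ :=
    le_bot_iff.1 (show φ ⊥ ≤ ⟨⊥, BinForest.admissible_bot⟩ from (φ.le_symm_apply).1 bot_le)
  have htop : φ ⊤ = top := le_antisymm (le_top (a := (φ ⊤).1)) ((φ.symm_apply_le).1 le_top)
  let ρ : Set.Icc ⊥ T → ℕ := fun F => (T.cross (φ F).1).card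
  have hρ : StrictMono ρ := fun _ _ h => BinForest.card_cross_lt hT (φ.strictMono h)
  have h0 : ρ ⊥ = 0 := by simp only [ρ, hbot, BinForest.cross_bot, Finset.card_empty]
  have hs : ∀ x y, x < y → ∃ z, x ≤ z ∧ z ≤ y ∧ ρ z = ρ x + 1 := by
    intro x y h
    obtain ⟨z, h1, h2, h3⟩ := BinForest.exists_admissible_succ hT (φ.strictMono h)
    refine ⟨φ.symm z, (φ.le_symm_apply).2 h1, (φ.symm_apply_le).2 h2, ?_⟩
    simp only [ρ, φ.apply_symm_apply, h3]
  refine ⟨isLatticeOrder_of_exists_isGLB fun x y => ?_, isGradedPoset_of_rank hρ h0 hs, ?_⟩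
  · obtain ⟨z, hz⟩ := BinForest.exists_isGLB_admSetoid (φ x) (φ y)
    refine ⟨φ.symm z, φ.isGLB_image'.1 ?_⟩
    rwa [Set.image_pair, φ.apply_symm_apply]
  · have hsum := BinForest.sum_mobiusValue_mul_pow hT (X : ℤ[X]) top
    rw [BinForest.prod_cross_top hT] at hsum
    simp only [map_natCast]
    rw [← hsum, charPolynomial_eq hρ h0 hs (f := fun y => T.mobiusValue (φ y).1)
      (by rw [hbot, BinForest.mobiusValue_bot])]
    · refine Finset.sum_equiv φ.toEquiv (fun x => ?_) fun x _ => ?_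
      · simp only [Finset.mem_univ, Finset.mem_filter, true_and, true_iff]
        exact le_top (a := (φ x).1)
      · simp only [ρ, htop]
        rfl
    · intro y hy
      rw [← BinForest.sum_mobiusValue hT (φ y) fun h =>
        hy (φ.injective (Subtype.ext (h.trans hbot.symm)))]
      exact Finset.sum_equiv φ.toEquiv (fun x => by simp) fun _ _ => rfl
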